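/- Let $n\ge 1$ and let $\langle\cdot,\cdot\rangle$, $|\cdot|$ be the standard inner product and norm of $\mathbb R^n$. A convex body is a compact convex subset of $\mathbb R^n$ with non-empty interior; its support function is $h_K(v)=\max\{\langle v,y\rangle : y\in K\}$. Let $\partial' K$ be the set of those $x\in\partial K$ for which there is exactly one $v\in\mathbb S^{n-1}$ with $\langle x,v\rangle=h_K(v)$, and write $\nu_K(x)$ for this $v$ (the Gauss map $\nu_K:\partial'K\to\mathbb S^{n-1}$). For $p,q>0$, an origin-symmetric convex body $K$ and a Borel set $\eta\subset\mathbb S^{n-1}$, the $L_p$ Gaussian dual curvature measure is $$\widetilde C_{p,\gamma_n,q}(K,\eta)=\int_{\nu_K^{-1}(\eta)}\langle x,\nu_K(x)\rangle^{1-p}\,|x|^{q-n}\,e^{-|x|^2/2}\,d\mathcal H^{n-1}(x),$$ where $\mathcal H^{n-1}$ is $(n-1)$-dimensional Hausdorff measure; its total mass is $|\widetilde C_{p,\gamma_n,q}(K,\cdot)|=\widetilde C_{p,\gamma_n,q}(K,\mathbb S^{n-1})$. Theorem 1.1 (restated as Theorem 4.3). Let $p,q>0$ (in particular, any $p,q>1$),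 and let $\mu$ be a nonzero finite Borel measure on $\mathbb S^{n-1}$ which has an even density $f\ge 0$ with respect to the spherical Lebesgue measure, i.e. $d\mu=f\,dv$ and $f(-v)=f(v)$ for all $v\in\mathbb S^{n-1}$. Then there exists an origin-symmetric convex body $K$ in $\mathbb R^n$ such that $0<|\widetilde C_{p,\gamma_n,q}(K,\cdot)|<\infty$ and $$\frac{\mu}{|\mu|}=\frac{\widetilde C_{p,\gamma_n,q}(K,\cdot)}{|\widetilde C_{p,\gamma_n,q}(K,\cdot)|},\qquad |\mu|=\mu(\mathbb S^{n-1}).$$ -/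

import Mathlib

open MeasureTheory Metric
open scoped ENNReal

noncomputable section

/-- The support function `h_K(v) = max {⟨v, y⟩ : y ∈ K}` of a (nonempty, compact) set `K`. -/
def supportFn {n : ℕ} (K : Set (EuclideanSpace ℝ (Fin n))) (v : EuclideanSpace ℝ (Fin n)) : ℝ :=
  sSup ((fun y => inner ℝ v y) '' K)

/-- The supporting hyperplane `H_K(v) = {x : ⟨x, v⟩ = h_K(v)}`. -/
def supportingHyperplane {n : ℕ} (K : Set (EuclideanSpace ℝ (Fin n)))
    (v : EuclideanSpace ℝ (Fin n)) : Set (EuclideanSpace ℝ (Fin n)) :=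
  {x | inner ℝ x v = supportFn K v}

/-- The spherical image of a point: all unit vectors `v` with `x ∈ H_K(v)`. -/
def sphericalImage {n : ℕ} (K : Set (EuclideanSpace ℝ (Fin n)))
    (x : EuclideanSpace ℝ (Fin n)) : Set (EuclideanSpace ℝ (Fin n)) :=
  {v | v ∈ sphere (0 : EuclideanSpace ℝ (Fin n)) 1 ∧ x ∈ supportingHyperplane K v}

/-- The set `∂'K` of boundary points of `K` with exactly one outer unit normal. -/
def regularBoundary {n : ℕ} (K : Set (EuclideanSpace ℝ (Fin n))) :
    Set (EuclideanSpace ℝ (Fin n)) :=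
  {x | x ∈ frontier K ∧ ∃! v, v ∈ sphericalImage K x}

open Classical in
/-- The Gauss map `ν_K`: the outer unit normal at a point of `∂'K`
(with the irrelevant value `0` elsewhere). -/
def gaussMap {n : ℕ} (K : Set (EuclideanSpace ℝ (Fin n)))
    (x : EuclideanSpace ℝ (Fin n)) : EuclideanSpace ℝ (Fin n) :=
  if h : x ∈ regularBoundary K then h.2.choose else 0

/-- The inverse Gauss image `ν_K⁻¹(η) = {x ∈ ∂'K : ν_K(x) ∈ η}` of a set `η` on the sphere. -/
def inverseGaussImage {n : ℕ} (K : Set (EuclideanSpace ℝ (Fin n)))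
    (η : Set (sphere (0 : EuclideanSpace ℝ (Fin n)) 1)) : Set (EuclideanSpace ℝ (Fin n)) :=
  {x | x ∈ regularBoundary K ∧ gaussMap K x ∈ (Subtype.val '' η)}

/-- The `(n-1)`-dimensional Hausdorff measure on `ℝⁿ` in its usual normalization. Mathlib's
`μH[d]` weighs a covering set by `(diam)ᵈ`; the usual one weighs it by the volume of the
`d`-dimensional Euclidean ball of the same diameter. -/
def surfaceHausdorff (n : ℕ) : Measure (EuclideanSpace ℝ (Fin n)) :=
  volume (ball (0 : EuclideanSpace ℝ (Fin (n - 1))) (1 / 2)) •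
    Measure.hausdorffMeasure ((n : ℝ) - 1)

/-- The `L_p` Gaussian dual curvature measure
`C̃_{p,γ_n,q}(K, η) = ∫_{ν_K⁻¹(η)} ⟨x, ν_K(x)⟩^{1-p} |x|^{q-n} e^{-|x|²/2} dℋⁿ⁻¹(x)`
of a Borel set `η` on the sphere. -/
def lpGaussianDualCurvature {n : ℕ} (p q : ℝ) (K : Set (EuclideanSpace ℝ (Fin n)))
    (η : Set (sphere (0 : EuclideanSpace ℝ (Fin n)) 1)) : ℝ≥0∞ :=
  ∫⁻ x in inverseGaussImage K η,
    ENNReal.ofReal ((inner ℝ x (gaussMap K x)) ^ (1 - p) * ‖x‖ ^ (q - (n : ℝ)) *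
      Real.exp (-(‖x‖ ^ 2) / 2)) ∂(surfaceHausdorff n)

end

/-! The problem is variational. Let m be the measure with density |z|^(q-n) exp(-|z|²/2) and J(K) =
∫ h_K^p dμ. Minimise J among origin-symmetric convex compacta with m(K) ≥ m(B), B the unit ball.
Since μ has a density, it does not charge great subspheres, so ∫ |⟨e,v⟩|^p dμ ≥ a|e|^p for some a >
0, and a bound on J bounds the body (`exists_pos_le_integral_abs_inner_rpow`). Compactness in the
Hausdorff metric and upper semicontinuity of m give a minimiser (`exists_minimizer`). Positive
m-mass keeps it out of every hyperplane, so by symmetry h_K > 0.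

Perturb the minimiser through the Wulff shapes of h_K exp(tφ), φ even. An envelope argument
differentiates the gauge in t for almost every direction u, and the first variation of m is ∫ ρ^q
exp(-ρ²/2) φ(ν) du, with ρ(u) the radial function and ν the normal at ρ(u)u
(`hasDerivAt_integral_radialPrimitive`). Minimality yields a multiplier c > 0, first against even φ
and then, both sides being symmetric, against every continuous function. Hence h_K^p μ is c times
the image under ν of ρ^q exp(-ρ²/2) du (`exists_multiplier_of_minimizer`,
`measure_eq_of_multiplier`).

It remains to recognise the curvature measure in polar coordinates, that is, ⟨x,ν⟩ dℋ^(n-1) is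
proportional to ρ^n du under x = ρ(u)u. This rests on `exists_coneMeasure_eq`: near a regular
boundary point the cone over a piece of the boundary is, up to bi-Lipschitz factors arbitrarily
close to 1, a straight cone over a flat base. Every constant, c included, cancels on dividing by
total masses; each only has to be nonzero and finite. -/

open Filter Topology Set

noncomputable section

set_option linter.unusedSectionVars false

/-! ### Gauge and normal directions of a Wulff shape -/

section Gauge

variable {E : Type*} [NormedAddCommGroup E] [InnerProductSpace ℝ E]

/-- The gauge function of the Wulff shape of a positive function on the unit sphere. -/
def wulffGauge (H : sphere (0 : E) 1 → ℝ) (z : E) : ℝ :=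
  ⨆ v : sphere (0 : E) 1, inner ℝ z (v : E) / H v

/-- The Wulff shape of a function on the unit sphere. -/
def wulffShape (H : sphere (0 : E) 1 → ℝ) : Set E :=
  {z | ∀ v : sphere (0 : E) 1, inner ℝ z (v : E) ≤ H v}

/-- The unit vector `v` realizes the supremum in the definition of `wulffGauge H z`. -/
def IsNormalDir (H : sphere (0 : E) 1 → ℝ) (z : E) (v : sphere (0 : E) 1) : Prop :=
  inner ℝ z (v : E) = wulffGauge H z * H v

/-- The nonzero vectors with exactly one normal direction. -/
def regularDirs (H : sphere (0 : E) 1 → ℝ) : Set E :=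
  {z | z ≠ 0 ∧ ∃! v, IsNormalDir H z v}

/-- Upper hemicontinuity of a set-valued map with closed graph and compact target, by the tube lemma
on the complement of W. It is applied to the normals as the point moves and as the Wulff shape
moves. -/
theorem eventually_forall_mem_of_isClosed {X Y : Type*} [TopologicalSpace X] [TopologicalSpace Y]
    [CompactSpace Y] {P : X → Y → Prop} (hP : IsClosed {a : X × Y | P a.1 a.2}) {x₀ : X}
    {W : Set Y} (hW : IsOpen W) (h : ∀ y, P x₀ y → y ∈ W) :
    ∀ᶠ x in 𝓝 x₀, ∀ y, P x y → y ∈ W := by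
  have h1 := (hW.isClosed_compl.isCompact).eventually_forall_of_forall_eventually
    (x₀ := x₀) (P := fun x y => ¬ P x y) (fun y hy =>
      hP.isOpen_compl.mem_nhds (x := (x₀, y)) (fun hc => hy (h y hc)))
  filter_upwards [h1] with x hx y hxy
  by_contra hy
  exact hx y hy hxy

variable {H : sphere (0 : E) 1 → ℝ}

theorem wulffShape_isClosed : IsClosed (wulffShape H) := by
  have : wulffShape H = ⋂ v : sphere (0 : E) 1, {z | inner ℝ z (v : E) ≤ H v} := by
    ext z; simp [wulffShape]
  rw [this]
  exact isClosed_iInter fun v =>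
    isClosed_le (continuous_id.inner continuous_const) continuous_const

theorem wulffShape_convex : Convex ℝ (wulffShape H) := by
  intro x hx y hy a b ha hb hab v
  rw [inner_add_left, real_inner_smul_left, real_inner_smul_left]
  calc a * inner ℝ x (v : E) + b * inner ℝ y (v : E) ≤ a * H v + b * H v := by
        gcongr
        · exact hx v
        · exact hy v
    _ = H v := by rw [← add_mul, hab, one_mul]

theorem neg_mem_wulffShape (he : ∀ v, H (-v) = H v) {x : E} (hx : x ∈ wulffShape H) :
    -x ∈ wulffShape H := by
  intro v
  have := hx (-v)
  rw [he] at this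
  simpa using this

theorem norm_sphere_coe (v : sphere (0 : E) 1) : ‖(v : E)‖ = 1 := by simp

variable [FiniteDimensional ℝ E]

theorem exists_lower_bound (hc : Continuous H) (hp : ∀ v, 0 < H v) :
    ∃ a, 0 < a ∧ ∀ v, a ≤ H v := by
  rcases isEmpty_or_nonempty (sphere (0 : E) 1) with h | h
  · exact ⟨1, one_pos, fun v => h.elim v⟩
  · obtain ⟨v, -, hv⟩ := isCompact_univ.exists_isMinOn univ_nonempty hc.continuousOn
    exact ⟨H v, hp v, fun w => hv (mem_univ w)⟩

theorem exists_upper_bound (hc : Continuous H) :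
    ∃ b, 0 < b ∧ ∀ v, H v ≤ b := by
  obtain ⟨b, hb⟩ := isCompact_univ.exists_bound_of_continuousOn hc.continuousOn
  exact ⟨max b 1, by positivity, fun w =>
    (le_abs_self _).trans ((hb w (mem_univ w)).trans (le_max_left _ _))⟩

theorem continuous_inner_div (hc : Continuous H) (hp : ∀ v, 0 < H v) (z : E) :
    Continuous fun v : sphere (0 : E) 1 => inner ℝ z (v : E) / H v :=
  (continuous_const.inner continuous_subtype_val).div hc fun v => (hp v).ne'

theorem inner_div_le_wulffGauge (hc : Continuous H) (hp : ∀ v, 0 < H v) (z : E)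
    (v : sphere (0 : E) 1) : inner ℝ z (v : E) / H v ≤ wulffGauge H z := by
  refine le_ciSup (f := fun v : sphere (0 : E) 1 => inner ℝ z (v : E) / H v) ?_ v
  have := (isCompact_univ (X := sphere (0 : E) 1)).bddAbove_image
    (continuous_inner_div hc hp z).continuousOn
  rwa [image_univ] at this

theorem inner_le_wulffGauge_mul (hc : Continuous H) (hp : ∀ v, 0 < H v) (z : E)
    (v : sphere (0 : E) 1) : inner ℝ z (v : E) ≤ wulffGauge H z * H v :=
  (div_le_iff₀ (hp v)).1 (inner_div_le_wulffGauge hc hp z v)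

theorem sphere_nonempty_of_ne_zero {z : E} (hz : z ≠ 0) : Nonempty (sphere (0 : E) 1) :=
  ⟨⟨‖z‖⁻¹ • z, by simp [norm_smul, hz]⟩⟩

theorem wulffGauge_pos (hc : Continuous H) (hp : ∀ v, 0 < H v) {z : E} (hz : z ≠ 0) :
    0 < wulffGauge H z := by
  set v : sphere (0 : E) 1 := ⟨‖z‖⁻¹ • z, by simp [norm_smul, hz]⟩ with hv
  refine lt_of_lt_of_le ?_ (inner_div_le_wulffGauge hc hp z v)
  refine div_pos ?_ (hp v)
  rw [hv]
  simp only [real_inner_smul_right, real_inner_self_eq_norm_sq]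
  have := norm_pos_iff.2 hz
  positivity

theorem wulffGauge_smul {c : ℝ} (hc : 0 ≤ c) (z : E) :
    wulffGauge H (c • z) = c * wulffGauge H z := by
  simp only [wulffGauge, real_inner_smul_left, mul_div_assoc]
  exact (Real.mul_iSup_of_nonneg hc _).symm

theorem wulffGauge_zero : wulffGauge H (0 : E) = 0 := by
  simp [wulffGauge]

theorem wulffGauge_nonneg (hc : Continuous H) (hp : ∀ v, 0 < H v) (z : E) :
    0 ≤ wulffGauge H z := by
  rcases eq_or_ne z 0 with rfl | hz
  · rw [wulffGauge_zero]
  · exact (wulffGauge_pos hc hp hz).le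

theorem norm_le_mul_wulffGauge (hc : Continuous H) (hp : ∀ v, 0 < H v) {b : ℝ}
    (hb : ∀ v, H v ≤ b) (z : E) : ‖z‖ ≤ b * wulffGauge H z := by
  rcases eq_or_ne z 0 with rfl | hz
  · simp [wulffGauge_zero]
  set v : sphere (0 : E) 1 := ⟨‖z‖⁻¹ • z, by simp [norm_smul, hz]⟩ with hv
  have h1 : inner ℝ z (v : E) = ‖z‖ := by
    rw [hv]
    simp only [real_inner_smul_right, real_inner_self_eq_norm_sq]
    have := norm_pos_iff.2 hz
    field_simp
  rw [← h1, mul_comm]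
  refine (inner_le_wulffGauge_mul hc hp z v).trans ?_
  exact mul_le_mul_of_nonneg_left (hb v) (wulffGauge_nonneg hc hp z)

theorem exists_isNormalDir [Nontrivial E] (hc : Continuous H) (hp : ∀ v, 0 < H v) (z : E) :
    ∃ v, IsNormalDir H z v := by
  obtain ⟨y, hy⟩ := exists_ne (0 : E)
  have := sphere_nonempty_of_ne_zero hy
  obtain ⟨v, -, hv⟩ := isCompact_univ.exists_isMaxOn univ_nonempty
    (continuous_inner_div hc hp z).continuousOn
  refine ⟨v, ?_⟩
  rw [IsNormalDir, ← div_eq_iff (hp v).ne']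
  exact le_antisymm (inner_div_le_wulffGauge hc hp z v) (ciSup_le fun w => hv (mem_univ w))

theorem mem_wulffShape_iff (hc : Continuous H) (hp : ∀ v, 0 < H v) [Nontrivial E] {z : E} :
    z ∈ wulffShape H ↔ wulffGauge H z ≤ 1 := by
  constructor
  · intro h
    obtain ⟨v, hv⟩ := exists_isNormalDir hc hp z
    rw [IsNormalDir, ← div_eq_iff (hp v).ne'] at hv
    rw [← hv, div_le_one (hp v)]
    exact h v
  · intro h v
    refine (inner_le_wulffGauge_mul hc hp z v).trans ?_
    exact mul_le_of_le_one_left (hp v).le h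

/-- The linear function ⟨·,v⟩/H(v) lies below the gauge everywhere and touches it at z, so v/H(v) is
a subgradient there. -/
theorem IsNormalDir.subgradient (hc : Continuous H) (hp : ∀ v, 0 < H v) {z : E}
    {v : sphere (0 : E) 1} (hv : IsNormalDir H z v) (w : E) :
    wulffGauge H z - wulffGauge H w ≤ inner ℝ (z - w) ((H v)⁻¹ • (v : E)) := by
  have h1 := inner_div_le_wulffGauge hc hp w v
  rw [IsNormalDir, ← div_eq_iff (hp v).ne'] at hv
  rw [real_inner_smul_right, inner_sub_left, mul_sub, inv_mul_eq_div, inv_mul_eq_div, hv]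
  linarith

theorem isNormalDir_smul_iff {c : ℝ} (hc : 0 < c) {z : E} {v : sphere (0 : E) 1} :
    IsNormalDir H (c • z) v ↔ IsNormalDir H z v := by
  simp only [IsNormalDir, real_inner_smul_left, wulffGauge_smul hc.le, mul_assoc]
  exact mul_right_inj' hc.ne'

theorem wulffGauge_neg (he : ∀ v, H (-v) = H v) (z : E) : wulffGauge H (-z) = wulffGauge H z := by
  rw [wulffGauge, wulffGauge, ← (Equiv.neg (sphere (0 : E) 1)).iSup_comp]
  simp [he]

theorem isNormalDir_neg_iff (he : ∀ v, H (-v) = H v) {z : E} {v : sphere (0 : E) 1} :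
    IsNormalDir H (-z) (-v) ↔ IsNormalDir H z v := by
  simp [IsNormalDir, wulffGauge_neg he, he]

theorem wulffGauge_sub_le [Nontrivial E] (hc : Continuous H) (hp : ∀ v, 0 < H v) {a : ℝ}
    (ha : 0 < a) (hb : ∀ v, a ≤ H v) (z w : E) :
    wulffGauge H z - wulffGauge H w ≤ a⁻¹ * ‖z - w‖ := by
  obtain ⟨v, hv⟩ := exists_isNormalDir hc hp z
  refine (hv.subgradient hc hp w).trans ((real_inner_le_norm _ _).trans ?_)
  rw [norm_smul, norm_sphere_coe, mul_one, norm_inv, Real.norm_of_nonneg (hp v).le, mul_comm]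
  gcongr
  exact hb v

theorem exists_lipschitzWith_wulffGauge [Nontrivial E] (hc : Continuous H) (hp : ∀ v, 0 < H v) :
    ∃ C, LipschitzWith C (wulffGauge H) := by
  obtain ⟨a, ha, hb⟩ := exists_lower_bound hc hp
  refine ⟨⟨a⁻¹, by positivity⟩, LipschitzWith.of_dist_le_mul fun z w => ?_⟩
  rw [Real.dist_eq, abs_sub_le_iff, dist_eq_norm]
  refine ⟨wulffGauge_sub_le hc hp ha hb z w, ?_⟩
  rw [norm_sub_rev]
  exact wulffGauge_sub_le hc hp ha hb w z

theorem continuous_wulffGauge [Nontrivial E] (hc : Continuous H) (hp : ∀ v, 0 < H v) :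
    Continuous (wulffGauge H) :=
  (exists_lipschitzWith_wulffGauge hc hp).choose_spec.continuous

theorem isClosed_isNormalDir [Nontrivial E] (hc : Continuous H) (hp : ∀ v, 0 < H v) :
    IsClosed {a : E × sphere (0 : E) 1 | IsNormalDir H a.1 a.2} :=
  isClosed_eq (continuous_fst.inner (continuous_subtype_val.comp continuous_snd))
    (((continuous_wulffGauge hc hp).comp continuous_fst).mul (hc.comp continuous_snd))

/-- Two normal directions with the same subgradient coincide. -/
theorem eq_of_inv_smul_eq (hp : ∀ v, 0 < H v) {v w : sphere (0 : E) 1}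
    (h : (H v)⁻¹ • (v : E) = (H w)⁻¹ • (w : E)) : v = w := by
  have h1 := congrArg norm h
  rw [norm_smul, norm_smul, norm_sphere_coe, norm_sphere_coe, norm_inv, norm_inv,
    Real.norm_of_nonneg (hp v).le, Real.norm_of_nonneg (hp w).le, mul_one, mul_one] at h1
  rw [h1] at h
  exact Subtype.ext (smul_right_injective E (inv_pos.2 (hp w)).ne' h)

/-- At a point of differentiability the only subgradient is the gradient, and v/H(v) determines v
because |v| = 1 and H > 0. -/
theorem mem_regularDirs_of_differentiableAt [Nontrivial E] (hc : Continuous H)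
    (hp : ∀ v, 0 < H v) {z : E} (hz : z ≠ 0) (hd : DifferentiableAt ℝ (wulffGauge H) z) :
    z ∈ regularDirs H := by
  have key : ∀ v, IsNormalDir H z v → ∀ y,
      fderiv ℝ (wulffGauge H) z y = (H v)⁻¹ * inner ℝ (v : E) y := by
    intro v hv y
    have hmin : IsLocalMin (fun w => wulffGauge H w - innerSL ℝ ((H v)⁻¹ • (v : E)) w) z := by
      refine Filter.Eventually.of_forall fun w => ?_
      have := hv.subgradient hc hp w
      rw [inner_sub_left, real_inner_comm, real_inner_comm _ w] at this
      simp only [innerSL_apply_apply]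
      linarith
    have h0 := hmin.hasFDerivAt_eq_zero
      (hd.hasFDerivAt.sub (innerSL ℝ ((H v)⁻¹ • (v : E))).hasFDerivAt)
    have := congrArg (fun L => L y) h0
    simpa [sub_eq_zero, real_inner_smul_left] using this
  obtain ⟨v, hv⟩ := exists_isNormalDir hc hp z
  refine ⟨hz, v, hv, fun w hw => eq_of_inv_smul_eq hp ?_⟩
  refine ext_inner_right ℝ fun y => ?_
  rw [real_inner_smul_left, real_inner_smul_left]
  exact (key w hw y).symm.trans (key v hv y)

theorem smul_mem_regularDirs_iff {c : ℝ} (hc : 0 < c) {z : E} :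
    c • z ∈ regularDirs H ↔ z ∈ regularDirs H := by
  simp [regularDirs, isNormalDir_smul_iff hc, hc.ne']

theorem neg_mem_regularDirs_iff (he : ∀ v, H (-v) = H v) {z : E} :
    -z ∈ regularDirs H ↔ z ∈ regularDirs H := by
  have : ∀ z, z ∈ regularDirs H → -z ∈ regularDirs H := by
    rintro z ⟨hz, v, hv, hu⟩
    refine ⟨neg_ne_zero.2 hz, -v, (isNormalDir_neg_iff he).2 hv, fun w hw => ?_⟩
    rw [← hu (-w) ((isNormalDir_neg_iff he).1 (by simpa using hw)), neg_neg]
  exact ⟨fun h => by simpa using this _ h, this z⟩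

open Classical in
/-- The outer unit normal of the Wulff shape in the direction of a regular vector. -/
def wulffNormal [Nontrivial E] (H : sphere (0 : E) 1 → ℝ) (z : E) : sphere (0 : E) 1 :=
  -- For continuous positive H the fallback is never reached. Off `regularDirs` the choice among
  -- several normals is arbitrary, so regularity of this map is only claimed on `regularDirs`.
  if h : ∃ v, IsNormalDir H z v then h.choose else Classical.choice
    (sphere_nonempty_of_ne_zero (exists_ne (0 : E)).choose_spec)

theorem isNormalDir_wulffNormal [Nontrivial E] (hc : Continuous H) (hp : ∀ v, 0 < H v) (z : E) :
    IsNormalDir H z (wulffNormal H z) := by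
  have h := exists_isNormalDir hc hp z
  rw [wulffNormal, dif_pos h]
  exact h.choose_spec

theorem wulffNormal_eq [Nontrivial E] (hc : Continuous H) (hp : ∀ v, 0 < H v) {z : E}
    (hz : z ∈ regularDirs H) {v : sphere (0 : E) 1} (hv : IsNormalDir H z v) :
    wulffNormal H z = v :=
  hz.2.unique (isNormalDir_wulffNormal hc hp z) hv

theorem wulffNormal_smul [Nontrivial E] (hc : Continuous H) (hp : ∀ v, 0 < H v) {z : E}
    (hz : z ∈ regularDirs H) {c : ℝ} (hcp : 0 < c) : wulffNormal H (c • z) = wulffNormal H z :=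
  wulffNormal_eq hc hp ((smul_mem_regularDirs_iff hcp).2 hz)
    ((isNormalDir_smul_iff hcp).2 (isNormalDir_wulffNormal hc hp z))

theorem wulffNormal_neg [Nontrivial E] (hc : Continuous H) (hp : ∀ v, 0 < H v)
    (he : ∀ v, H (-v) = H v) {z : E} (hz : z ∈ regularDirs H) :
    wulffNormal H (-z) = - wulffNormal H z :=
  wulffNormal_eq hc hp ((neg_mem_regularDirs_iff he).2 hz)
    ((isNormalDir_neg_iff he).2 (isNormalDir_wulffNormal hc hp z))

/-- Every normal at a nearby point is controlled, whether or not that point is regular. -/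
theorem eventually_normal_mem [Nontrivial E] (hc : Continuous H) (hp : ∀ v, 0 < H v) {z : E}
    (hz : z ∈ regularDirs H) {W : Set (sphere (0 : E) 1)} (hW : W ∈ 𝓝 (wulffNormal H z)) :
    ∀ᶠ w in 𝓝 z, ∀ v, IsNormalDir H w v → v ∈ W := by
  have := eventually_forall_mem_of_isClosed (isClosed_isNormalDir hc hp) (x₀ := z)
    isOpen_interior (fun y hy => by
      rw [← wulffNormal_eq hc hp hz hy]
      exact mem_interior_iff_mem_nhds.2 hW)
  filter_upwards [this] with w hw v hv using interior_subset (hw v hv)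

theorem continuousOn_wulffNormal [Nontrivial E] (hc : Continuous H) (hp : ∀ v, 0 < H v) :
    ContinuousOn (wulffNormal H) (regularDirs H) := by
  intro z hz
  refine ContinuousAt.continuousWithinAt fun W hW => mem_map.2 ?_
  filter_upwards [eventually_normal_mem hc hp hz hW] with w hw
  exact hw _ (isNormalDir_wulffNormal hc hp w)

variable [MeasurableSpace E] [BorelSpace E]

/-- Apart from 0, the irregular vectors are those with two normals at distance at least 1/(k+1) for
some k. For fixed k this is the projection of a closed set along a compact factor, hence closed. -/
theorem measurableSet_regularDirs [Nontrivial E] (hc : Continuous H) (hp : ∀ v, 0 < H v) :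
    MeasurableSet (regularDirs H) := by
  let Z : ℕ → Set (E × (sphere (0 : E) 1 × sphere (0 : E) 1)) := fun k =>
    {a | IsNormalDir H a.1 a.2.1 ∧ IsNormalDir H a.1 a.2.2 ∧ 1 / ((k : ℝ) + 1) ≤ dist a.2.1 a.2.2}
  have hZ : ∀ k, IsClosed (Z k) := fun k =>
    ((isClosed_isNormalDir hc hp).preimage (f := fun a : E × (sphere (0 : E) 1 × sphere (0 : E) 1) =>
      (a.1, a.2.1)) (by fun_prop)).inter
    (((isClosed_isNormalDir hc hp).preimage (f := fun a : E × (sphere (0 : E) 1 × sphere (0 : E) 1)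
      => (a.1, a.2.2)) (by fun_prop)).inter
      (isClosed_le continuous_const
        (continuous_snd.fst.dist continuous_snd.snd)))
  have : regularDirs H = ({0} ∪ ⋃ k, Prod.fst '' Z k)ᶜ := by
    ext z
    simp only [mem_compl_iff, mem_union, mem_singleton_iff, mem_iUnion, not_or, not_exists]
    constructor
    · rintro ⟨hz, hu⟩
      refine ⟨hz, ?_⟩
      rintro k ⟨⟨z', v, w⟩, ⟨h1, h2, h3⟩, rfl⟩
      have : v = w := hu.unique h1 h2
      subst this
      rw [dist_self] at h3
      exact absurd h3 (not_le.2 (by positivity))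
    · rintro ⟨hz, h⟩
      obtain ⟨v, hv⟩ := exists_isNormalDir hc hp z
      refine ⟨hz, v, hv, fun w hw => ?_⟩
      by_contra hne
      obtain ⟨k, hk⟩ := exists_nat_one_div_lt (dist_pos.2 hne)
      exact h k ⟨(z, w, v), ⟨hw, hv, hk.le⟩, rfl⟩
  rw [this]
  exact ((measurableSet_singleton _).union (MeasurableSet.iUnion fun k =>
    (isClosedMap_fst_of_compactSpace _ (hZ k)).measurableSet)).compl

/-- Rademacher's theorem for the Lipschitz gauge. -/
theorem ae_mem_regularDirs [Nontrivial E] (hc : Continuous H) (hp : ∀ v, 0 < H v)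
    (μ : Measure E) [μ.IsAddHaarMeasure] : ∀ᵐ z ∂μ, z ∈ regularDirs H := by
  obtain ⟨C, hC⟩ := exists_lipschitzWith_wulffGauge hc hp
  filter_upwards [hC.ae_differentiableAt (μ := μ), Measure.ae_ne μ 0] with z hz h0
  exact mem_regularDirs_of_differentiableAt hc hp h0 hz

end Gauge

/-! ### Comparing measures: localisation, Lipschitz maps, flat cones -/

section Comparison

/-- Lindelöf gives countably many of the neighbourhoods covering R; cutting A into disjoint pieces
subordinate to them reduces to countable additivity. -/
theorem measure_le_of_locally_le {X : Type*} [TopologicalSpace X] [SecondCountableTopology X]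
    [MeasurableSpace X] [BorelSpace X] {μ ν : Measure X} {R : Set X}
    (h : ∀ x ∈ R, ∃ V ∈ 𝓝 x, ∀ A ⊆ R ∩ V, MeasurableSet A → μ A ≤ ν A) {A : Set X}
    (hA : A ⊆ R) (hm : MeasurableSet A) : μ A ≤ ν A := by
  choose! V hV hle using h
  obtain ⟨t, htR, htc, hcov⟩ := TopologicalSpace.countable_cover_nhdsWithin
    (f := fun x => interior (V x)) (s := R)
    (fun x hx => mem_nhdsWithin_of_mem_nhds (interior_mem_nhds.2 (hV x hx)))
  rcases t.eq_empty_or_nonempty with rfl | hne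
  · have : A = ∅ := by simpa using hA.trans hcov
    simp [this]
  obtain ⟨f, rfl⟩ := htc.exists_eq_range hne
  let U : ℕ → Set X := fun i => interior (V (f i))
  have hU : ∀ i, MeasurableSet (A ∩ disjointed U i) := fun i =>
    hm.inter (MeasurableSet.disjointed (fun i => isOpen_interior.measurableSet) i)
  have hA' : A = ⋃ i, A ∩ disjointed U i := by
    rw [← inter_iUnion, iUnion_disjointed, inter_eq_left.2]
    intro x hx
    simpa [U] using hcov (hA hx)
  have hd : Pairwise (Function.onFun Disjoint fun i => A ∩ disjointed U i) := fun i j hij =>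
    (disjoint_disjointed U hij).mono inter_subset_right inter_subset_right
  rw [hA', measure_iUnion hd hU, measure_iUnion hd hU]
  refine ENNReal.tsum_le_tsum fun i => hle (f i) (htR ⟨i, rfl⟩) _ ?_ (hU i)
  exact inter_subset_inter hA ((disjointed_subset U i).trans interior_subset)

/-- The inverse of f on its image is K-Lipschitz. -/
theorem hausdorffMeasure_le_image_of_antilipschitzOn {X Y : Type*} [MetricSpace X]
    [MetricSpace Y] [MeasurableSpace X] [BorelSpace X] [MeasurableSpace Y] [BorelSpace Y]
    {K : NNReal} {f : X → Y} {s : Set X}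
    (h : ∀ x ∈ s, ∀ y ∈ s, dist x y ≤ K * dist (f x) (f y)) {d : ℝ} (hd : 0 ≤ d) :
    Measure.hausdorffMeasure d s ≤ (K : ℝ≥0∞) ^ d * Measure.hausdorffMeasure d (f '' s) := by
  rcases s.eq_empty_or_nonempty with rfl | ⟨x₀, hx₀⟩
  · simp
  have hinj : InjOn f s := by
    intro x hx y hy hxy
    have := h x hx y hy
    rw [hxy, dist_self, mul_zero] at this
    exact dist_le_zero.1 this
  have : Nonempty X := ⟨x₀⟩
  have hl : LipschitzOnWith K (Function.invFunOn f s) (f '' s) := by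
    refine LipschitzOnWith.of_dist_le_mul ?_
    rintro _ ⟨x, hx, rfl⟩ _ ⟨y, hy, rfl⟩
    rw [hinj.leftInvOn_invFunOn hx, hinj.leftInvOn_invFunOn hy]
    exact h x hx y hy
  have himg : Function.invFunOn f s '' (f '' s) = s := by
    rw [image_image]
    exact (image_congr fun x hx => hinj.leftInvOn_invFunOn hx).trans (image_id s)
  have := hl.hausdorffMeasure_image_le hd
  rwa [himg] at this

variable {E : Type*} [NormedAddCommGroup E] [InnerProductSpace ℝ E] [FiniteDimensional ℝ E]
  [MeasurableSpace E] [BorelSpace E]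

/-- Uniqueness of Haar measure. With volume a multiple of Hausdorff measure, volumes of Lipschitz
images are bounded without Jacobians; the value of c plays no role. -/
theorem exists_volume_eq_smul_hausdorffMeasure {d : ℕ} (hd : Module.finrank ℝ E = d) :
    ∃ c : ℝ≥0∞, c ≠ 0 ∧ c ≠ ∞ ∧
      (volume : Measure E) = c • Measure.hausdorffMeasure (d : ℝ) := by
  have := isAddHaarMeasure_hausdorffMeasure (E := E)
  subst hd
  refine ⟨Measure.addHaarScalarFactor (volume : Measure E)
    (Measure.hausdorffMeasure (Module.finrank ℝ E : ℝ)), ?_, ENNReal.coe_ne_top, ?_⟩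
  · exact_mod_cast (Measure.addHaarScalarFactor_pos_of_isAddHaarMeasure _ _).ne'
  · exact Measure.isAddLeftInvariant_eq_smul _ _

theorem volume_image_le_of_lipschitzOn {d : ℕ} (hd : Module.finrank ℝ E = d)
    {K : NNReal} {f : E → E} {s : Set E} (h : LipschitzOnWith K f s) :
    volume (f '' s) ≤ (K : ℝ≥0∞) ^ d * volume s := by
  obtain ⟨c, -, -, hc⟩ := exists_volume_eq_smul_hausdorffMeasure hd
  rw [hc, Measure.smul_apply, Measure.smul_apply, smul_eq_mul, smul_eq_mul, mul_left_comm]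
  gcongr
  simpa using h.hausdorffMeasure_image_le (d := d) (by positivity)

theorem volume_le_image_of_antilipschitzOn {d : ℕ} (hd : Module.finrank ℝ E = d)
    {K : NNReal} {f : E → E} {s : Set E}
    (h : ∀ x ∈ s, ∀ y ∈ s, dist x y ≤ K * dist (f x) (f y)) :
    volume s ≤ (K : ℝ≥0∞) ^ d * volume (f '' s) := by
  obtain ⟨c, -, -, hc⟩ := exists_volume_eq_smul_hausdorffMeasure hd
  rw [hc, Measure.smul_apply, Measure.smul_apply, smul_eq_mul, smul_eq_mul, mul_left_comm]
  gcongr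
  simpa using hausdorffMeasure_le_image_of_antilipschitzOn h (d := d) (by positivity)

/-- The open cone over `B × {h}` with apex at the origin. -/
def flatCone {F : Type*} [SMul ℝ F] (B : Set F) (h : ℝ) : Set (F × ℝ) :=
  {p | p.2 ∈ Ioo 0 h ∧ (h / p.2) • p.1 ∈ B}

theorem measurableSet_flatCone {F : Type*} [NormedAddCommGroup F] [NormedSpace ℝ F]
    [FiniteDimensional ℝ F] [MeasurableSpace F] [BorelSpace F] {B : Set F} (hB : MeasurableSet B)
    (h : ℝ) : MeasurableSet (flatCone B h) := by
  have h1 : Measurable fun p : F × ℝ => (h / p.2) • p.1 :=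
    (measurable_const.div measurable_snd).smul measurable_fst
  exact (measurable_snd measurableSet_Ioo).inter (h1 hB)

/-- Fubini in the height: the slice at height y is (y/h)B, of volume (y/h)^k |B|. -/
theorem volume_flatCone {F : Type*} [NormedAddCommGroup F] [InnerProductSpace ℝ F]
    [FiniteDimensional ℝ F] [MeasurableSpace F] [BorelSpace F] {k : ℕ}
    (hk : Module.finrank ℝ F = k) {B : Set F} (hB : MeasurableSet B) {h : ℝ} (hh : 0 < h) :
    volume (flatCone B h) = ENNReal.ofReal (h / (k + 1)) * volume B := by
  have h1 : ∀ y : ℝ, volume ((fun x => (x, y)) ⁻¹' flatCone B h) =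
      (Ioo 0 h).indicator (fun y => ENNReal.ofReal ((y / h) ^ k) * volume B) y := by
    intro y
    by_cases hy : y ∈ Ioo 0 h
    · have : (fun x : F => (x, y)) ⁻¹' flatCone B h = (fun x => (h / y) • x) ⁻¹' B := by
        ext x; simp [flatCone, hy.1, hy.2]
      rw [this, Measure.addHaar_preimage_smul _ (div_pos hh hy.1).ne', indicator_of_mem hy, hk,
        abs_of_nonneg (by have := hy.1; positivity), ← inv_pow, inv_div]
    · have : (fun x : F => (x, y)) ⁻¹' flatCone B h = ∅ := by
        ext x
        simp only [flatCone, mem_preimage, mem_ofPred_eq, mem_empty_iff_false, iff_false, not_and]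
        exact fun hc => absurd hc hy
      rw [this, measure_empty, indicator_of_notMem hy]
  rw [Measure.volume_eq_prod, Measure.prod_apply_symm (measurableSet_flatCone hB h)]
  simp_rw [h1]
  rw [lintegral_indicator measurableSet_Ioo,
    lintegral_mul_const _ (by fun_prop)]
  congr 1
  rw [setLIntegral_congr Ioo_ae_eq_Ioc, ← ofReal_integral_eq_lintegral_ofReal]
  · congr 1
    rw [← intervalIntegral.integral_of_le hh.le]
    simp_rw [div_pow]
    rw [intervalIntegral.integral_div, integral_pow]
    field_simp
    simp [pow_succ]
  · exact (Continuous.integrableOn_Icc (by fun_prop)).mono_set Ioc_subset_Icc_self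
  · filter_upwards [ae_restrict_mem measurableSet_Ioc] with y hy
    have := hy.1
    simp only [Pi.zero_apply]
    positivity

/-- Any isometry works after composing with the reflection that carries the image of (0,1) to v. -/
theorem exists_linearIsometryEquiv_prod_real {k : ℕ} (hE : Module.finrank ℝ E = k + 1)
    (v : sphere (0 : E) 1) :
    ∃ T : WithLp 2 (EuclideanSpace ℝ (Fin k) × ℝ) ≃ₗᵢ[ℝ] E, T (WithLp.toLp 2 (0, 1)) = v := by
  have hX : Module.finrank ℝ (WithLp 2 (EuclideanSpace ℝ (Fin k) × ℝ)) = k + 1 := by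
    rw [(WithLp.linearEquiv 2 ℝ _).finrank_eq]
    simp
  let T₀ : WithLp 2 (EuclideanSpace ℝ (Fin k) × ℝ) ≃ₗᵢ[ℝ] E :=
    (stdOrthonormalBasis ℝ _).equiv (stdOrthonormalBasis ℝ E) (finCongr (hX.trans hE.symm))
  refine ⟨T₀.trans ((ℝ ∙ (T₀ (WithLp.toLp 2 (0, 1)) - (v : E)))ᗮ.reflection), ?_⟩
  rw [LinearIsometryEquiv.trans_apply]
  apply Submodule.reflection_sub
  rw [LinearIsometryEquiv.norm_map, norm_sphere_coe, ← sq_eq_sq₀ (norm_nonneg _) zero_le_one,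
    WithLp.prod_norm_sq_eq_of_L2]
  simp

theorem volume_image_linearIsometryEquiv_prod {F : Type*} [NormedAddCommGroup F]
    [InnerProductSpace ℝ F] [FiniteDimensional ℝ F] [MeasurableSpace F] [BorelSpace F]
    (T : WithLp 2 (F × ℝ) ≃ₗᵢ[ℝ] E) {s : Set (F × ℝ)} (hs : MeasurableSet s) :
    volume ((fun p => T (WithLp.toLp 2 p)) '' s) = volume s := by
  have h1 : MeasurePreserving (fun x : E => (T.symm x).ofLp) :=
    (WithLp.volume_preserving_ofLp F ℝ).comp T.symm.measurePreserving
  rw [← h1.measure_preimage hs.nullMeasurableSet]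
  congr 1
  ext x
  constructor
  · rintro ⟨p, hp, rfl⟩
    simpa using hp
  · intro hx
    exact ⟨_, hx, by simp⟩

end Comparison

/-! ### Cone measure versus surface measure -/

section AreaFormula

variable {E : Type*} [NormedAddCommGroup E] [InnerProductSpace ℝ E] [FiniteDimensional ℝ E]
  {H : sphere (0 : E) 1 → ℝ}

/-- The boundary points of the Wulff shape with exactly one normal direction. -/
def wulffRegularBoundary (H : sphere (0 : E) 1 → ℝ) : Set E :=
  {x | wulffGauge H x = 1 ∧ x ∈ regularDirs H}

/-- The points of the open Wulff shape whose radial projection to the boundary lies in `A`. -/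
def radialCone (H : sphere (0 : E) 1 → ℝ) (A : Set E) : Set E :=
  {z | wulffGauge H z ∈ Ioo 0 1 ∧ (wulffGauge H z)⁻¹ • z ∈ A}

/-- If the rescaled normals at z and w are within ε of v₀, then H(v₀) times the gauge increases
between them like ⟨·,v₀⟩ up to ε|z-w|: the subgradient at z bounds the increment from above, the one
at w from below. -/
theorem abs_wulffGauge_sub_sub_le (hc : Continuous H) (hp : ∀ v, 0 < H v)
    {v₀ v₁ v₂ : sphere (0 : E) 1} {ε : ℝ} {z w : E} (h1 : IsNormalDir H z v₁)
    (h2 : IsNormalDir H w v₂) (h1' : ‖(H v₀ / H v₁) • (v₁ : E) - v₀‖ ≤ ε)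
    (h2' : ‖(H v₀ / H v₂) • (v₂ : E) - v₀‖ ≤ ε) :
    |H v₀ * (wulffGauge H z - wulffGauge H w) - inner ℝ (z - w) (v₀ : E)| ≤ ε * ‖z - w‖ := by
  have key : ∀ (z w : E) (v : sphere (0 : E) 1), IsNormalDir H z v →
      ‖(H v₀ / H v) • (v : E) - v₀‖ ≤ ε →
      H v₀ * (wulffGauge H z - wulffGauge H w) - inner ℝ (z - w) (v₀ : E) ≤ ε * ‖z - w‖ := by
    intro z w v hv hε
    have h := mul_le_mul_of_nonneg_left (hv.subgradient hc hp w) (hp v₀).le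
    have h3 : H v₀ * inner ℝ (z - w) ((H v)⁻¹ • (v : E)) - inner ℝ (z - w) (v₀ : E) =
        inner ℝ (z - w) ((H v₀ / H v) • (v : E) - v₀) := by
      rw [inner_sub_right, real_inner_smul_right, real_inner_smul_right, div_eq_mul_inv, mul_assoc]
    calc _ ≤ inner ℝ (z - w) ((H v₀ / H v) • (v : E) - v₀) := by linarith
      _ ≤ ‖z - w‖ * ‖(H v₀ / H v) • (v : E) - v₀‖ := real_inner_le_norm _ _
      _ ≤ ε * ‖z - w‖ := by rw [mul_comm]; gcongr
  rw [abs_le]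
  constructor
  · have := key w z v₂ h2 h2'
    rw [norm_sub_rev, ← neg_sub z w, inner_neg_left] at this
    linarith
  · exact key z w v₁ h1 h1'

theorem wulffRegularBoundary_apply_eq (hc : Continuous H) (hp : ∀ v, 0 < H v) [Nontrivial E]
    {x : E} (hx : x ∈ wulffRegularBoundary H) :
    inner ℝ x (wulffNormal H x : E) = H (wulffNormal H x) := by
  have := isNormalDir_wulffNormal hc hp x
  rwa [IsNormalDir, hx.1, one_mul] at this

variable [MeasurableSpace E] [BorelSpace E]

theorem measurableSet_wulffRegularBoundary [Nontrivial E] (hc : Continuous H)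
    (hp : ∀ v, 0 < H v) : MeasurableSet (wulffRegularBoundary H) :=
  ((continuous_wulffGauge hc hp).measurable (measurableSet_singleton 1)).inter
    (measurableSet_regularDirs hc hp)

theorem measurable_inv_wulffGauge_smul [Nontrivial E] (hc : Continuous H) (hp : ∀ v, 0 < H v) :
    Measurable fun z => (wulffGauge H z)⁻¹ • z :=
  (continuous_wulffGauge hc hp).measurable.inv.smul measurable_id

/-- Near x₀ all normals are close to v₀. The map ψ replaces the v₀-coordinate of z by h₀ g(z); it is
close to the identity and carries the radial cone over A to the straight cone of height h₀ over the
projection π(A). The factor K^(2k+2) collects K^(k+1) from ψ in dimension k+1, K^k from π in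
dimension k, and K from the oscillation of H. -/
theorem exists_nhds_radialCone_comparison [Nontrivial E] {k : ℕ}
    (hE : Module.finrank ℝ E = k + 1) (hc : Continuous H) (hp : ∀ v, 0 < H v) {c : ℝ≥0∞}
    (hcF : (volume : Measure (EuclideanSpace ℝ (Fin k))) = c • Measure.hausdorffMeasure (k : ℝ))
    {x₀ : E} (hx₀ : x₀ ∈ wulffRegularBoundary H) {K : NNReal} (hK : 1 < K) :
    ∃ V ∈ 𝓝 x₀, ∀ A ⊆ wulffRegularBoundary H ∩ V, MeasurableSet A →
      (ENNReal.ofReal (1 / (k + 1)) * c * ∫⁻ x in A, ENNReal.ofReal (H (wulffNormal H x))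
          ∂(Measure.hausdorffMeasure (k : ℝ)) ≤ (K : ℝ≥0∞) ^ (2 * k + 2) *
            volume (radialCone H A)) ∧
      (volume (radialCone H A) ≤ (K : ℝ≥0∞) ^ (2 * k + 2) * (ENNReal.ofReal (1 / (k + 1)) * c *
        ∫⁻ x in A, ENNReal.ofReal (H (wulffNormal H x))
          ∂(Measure.hausdorffMeasure (k : ℝ)))) := by
  set v₀ := wulffNormal H x₀ with hv₀
  set h₀ := H v₀ with hh₀
  have hh₀p : 0 < h₀ := hp v₀
  have hK0 : (0 : ℝ) < K := by exact_mod_cast zero_lt_one.trans hK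
  have hK1 : (1 : ℝ) < K := by exact_mod_cast hK
  obtain ⟨ε, hε0, hε1, hε2⟩ : ∃ ε : ℝ, 0 < ε ∧ 1 + ε ≤ K ∧ 1 ≤ K * (1 - ε) := by
    -- ε = 1 - 1/K makes (1-ε)K = 1, while 1+ε ≤ K is K + 1/K ≥ 2.
    refine ⟨1 - (K : ℝ)⁻¹, sub_pos.2 (inv_lt_one_of_one_lt₀ hK1), ?_, by field_simp; simp⟩
    have : (K : ℝ) + (K : ℝ)⁻¹ - 2 = (K - 1) ^ 2 / K := by field_simp; ring
    have : 0 ≤ ((K : ℝ) - 1) ^ 2 / K := by positivity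
    linarith
  have hcont : Continuous fun v : sphere (0 : E) 1 => ‖(h₀ / H v) • (v : E) - v₀‖ :=
    (((continuous_const.div hc fun v => (hp v).ne').smul continuous_subtype_val).sub
      continuous_const).norm
  have hW : {v : sphere (0 : E) 1 | ‖(h₀ / H v) • (v : E) - v₀‖ < ε ∧ H v < K * h₀ ∧
      h₀ < K * H v} ∈ 𝓝 v₀ := by
    have h1 : ∀ᶠ v in 𝓝 v₀, ‖(h₀ / H v) • (v : E) - v₀‖ < ε :=
      hcont.continuousAt.eventually_lt continuousAt_const (by simp [← hh₀, hh₀p.ne', hε0])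
    have h2 : ∀ᶠ v in 𝓝 v₀, H v < K * h₀ :=
      hc.continuousAt.eventually_lt continuousAt_const (by rw [← hh₀]; nlinarith)
    have h3 : ∀ᶠ v in 𝓝 v₀, h₀ < K * H v :=
      continuousAt_const.eventually_lt (continuous_const.mul hc).continuousAt
        (by rw [← hh₀]; nlinarith)
    exact h1.and (h2.and h3)
  refine ⟨_, eventually_normal_mem hc hp hx₀.2 hW, fun A hA hAm => ?_⟩
  obtain ⟨T, hT⟩ := exists_linearIsometryEquiv_prod_real hE v₀
  have hTv : T.symm (v₀ : E) = WithLp.toLp 2 (0, 1) := by rw [← hT, T.symm_apply_apply]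
  have hsnd : ∀ z, (T.symm z).snd = inner ℝ z (v₀ : E) := by
    intro z
    rw [← T.symm.inner_map_map, hTv, WithLp.prod_inner_apply]
    simp
  set π : E → EuclideanSpace ℝ (Fin k) := fun z => (T.symm z).fst with hπ
  have hπsmul : ∀ (t : ℝ) z, π (t • z) = t • π z := fun t z => by simp [hπ]
  have hπsub : ∀ z w, π z - π w = π (z - w) := fun z w => by simp [hπ]
  have hnorm : ∀ z, ‖z‖ ^ 2 = ‖π z‖ ^ 2 + inner ℝ z (v₀ : E) ^ 2 := by
    intro z
    rw [← T.symm.norm_map z, WithLp.prod_norm_sq_eq_of_L2, hsnd, Real.norm_eq_abs, sq_abs]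
  have hπcont : Continuous π := by
    have : Continuous fun z => (T.symm z).ofLp.1 :=
      continuous_fst.comp ((WithLp.prod_continuous_ofLp 2 _ _).comp T.symm.continuous)
    exact this
  have hπle : ∀ z, ‖π z‖ ≤ ‖z‖ := fun z => by
    refine (sq_le_sq₀ (norm_nonneg _) (norm_nonneg _)).1 ?_
    rw [hnorm z]; nlinarith [sq_nonneg (inner ℝ z (v₀ : E))]
  set g := wulffGauge H with hg
  set ψ : E → E := fun z => z + (h₀ * g z - inner ℝ z (v₀ : E)) • (v₀ : E) with hψ
  have hψT : ∀ z, ψ z = T (WithLp.toLp 2 (π z, h₀ * g z)) := by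
    intro z
    apply T.symm.injective
    rw [T.symm_apply_apply, hψ]
    simp only [map_add, map_smul, hTv]
    refine WithLp.ofLp_injective 2 (Prod.ext ?_ ?_)
    · simp [hπ]
    · simp [hsnd]
  set P := radialCone H A with hP
  have hnA : ∀ a ∈ A, ∃ v, IsNormalDir H a v ∧ ‖(h₀ / H v) • (v : E) - v₀‖ ≤ ε ∧
      H v ≤ K * h₀ ∧ h₀ ≤ K * H v := fun a ha => by
    have hv := isNormalDir_wulffNormal hc hp a
    have := (hA ha).2 _ hv
    exact ⟨_, hv, this.1.le, this.2.1.le, this.2.2.le⟩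
  -- Normals are constant along rays, so the control near x₀ extends over the whole cone, down to
  -- its apex.
  have hnP : ∀ a ∈ P, ∃ v, IsNormalDir H a v ∧ ‖(h₀ / H v) • (v : E) - v₀‖ ≤ ε := fun a ha => by
    obtain ⟨v, hv, h1, -⟩ := hnA _ ha.2
    exact ⟨v, (isNormalDir_smul_iff (inv_pos.2 ha.1.1)).1 hv, h1⟩
  have hψd : ∀ z w, ψ z - ψ w = (z - w) +
      (h₀ * (g z - g w) - inner ℝ (z - w) (v₀ : E)) • (v₀ : E) := by
    intro z w
    simp only [hψ, inner_sub_left]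
    module
  have hψn : ∀ z ∈ P, ∀ w ∈ P, ‖(ψ z - ψ w) - (z - w)‖ ≤ ε * ‖z - w‖ := by
    intro z hz w hw
    obtain ⟨v₁, h1, h1'⟩ := hnP z hz
    obtain ⟨v₂, h2, h2'⟩ := hnP w hw
    rw [hψd, add_sub_cancel_left, norm_smul, norm_sphere_coe, mul_one, Real.norm_eq_abs]
    exact abs_wulffGauge_sub_sub_le hc hp h1 h2 h1' h2'
  have hψlip : LipschitzOnWith K ψ P := LipschitzOnWith.of_dist_le_mul fun z hz w hw => by
    rw [dist_eq_norm, dist_eq_norm]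
    have h1 := hψn z hz w hw
    have h2 := norm_add_le ((ψ z - ψ w) - (z - w)) (z - w)
    rw [sub_add_cancel] at h2
    nlinarith [norm_nonneg (z - w)]
  have hψanti : ∀ z ∈ P, ∀ w ∈ P, dist z w ≤ K * dist (ψ z) (ψ w) := fun z hz w hw => by
    rw [dist_eq_norm, dist_eq_norm]
    have h1 := hψn z hz w hw
    have h2 := norm_sub_norm_le (z - w) (ψ z - ψ w)
    rw [norm_sub_rev (z - w)] at h2
    have h3 : (1 - ε) * ‖z - w‖ ≤ ‖ψ z - ψ w‖ := by linarith
    nlinarith [norm_nonneg (z - w)]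
  -- On A the gauge is constantly 1, so the v₀-component of z-w is at most ε|z-w| and the projection
  -- loses almost nothing.
  have hπanti : ∀ z ∈ A, ∀ w ∈ A, dist z w ≤ K * dist (π z) (π w) := fun z hz w hw => by
    rw [dist_eq_norm, dist_eq_norm, hπsub]
    obtain ⟨v₁, h1, h1', -⟩ := hnA z hz
    obtain ⟨v₂, h2, h2', -⟩ := hnA w hw
    have h3 := abs_wulffGauge_sub_sub_le hc hp h1 h2 h1' h2'
    rw [(hA hz).1.1, (hA hw).1.1, sub_self, mul_zero, zero_sub, abs_neg] at h3
    have h4 : ‖z - w‖ ≤ ‖π (z - w)‖ + |inner ℝ (z - w) (v₀ : E)| := by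
      refine (sq_le_sq₀ (norm_nonneg _) (by positivity)).1 ?_
      rw [hnorm (z - w), add_sq, sq_abs]
      have : 0 ≤ 2 * ‖π (z - w)‖ * |inner ℝ (z - w) (v₀ : E)| := by positivity
      linarith
    have h5 : (1 - ε) * ‖z - w‖ ≤ ‖π (z - w)‖ := by linarith
    nlinarith [norm_nonneg (z - w)]
  have hπlip : LipschitzOnWith 1 π A := LipschitzOnWith.of_dist_le_mul fun z hz w hw => by
    rw [dist_eq_norm, dist_eq_norm, hπsub, NNReal.coe_one, one_mul]
    exact hπle _
  have hπinj : InjOn π A := fun x hx y hy hxy => by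
    have := hπanti x hx y hy
    rw [hxy, dist_self, mul_zero] at this
    exact dist_le_zero.1 this
  have hBm : MeasurableSet (π '' A) := hAm.image_of_continuousOn_injOn hπcont.continuousOn hπinj
  have himg : ψ '' P = (fun p => T (WithLp.toLp 2 p)) '' flatCone (π '' A) h₀ := by
    ext y
    constructor
    · rintro ⟨z, hz, rfl⟩
      refine ⟨(π z, h₀ * g z), ⟨⟨mul_pos hh₀p hz.1.1, mul_lt_of_lt_one_right hh₀p hz.1.2⟩,
        _, hz.2, ?_⟩, (hψT z).symm⟩
      have := hz.1.1.ne'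
      rw [hπsmul]
      congr 1
      simp only [← hg] at this ⊢
      field_simp
    · rintro ⟨⟨y, s⟩, ⟨⟨hs0, hs1⟩, a, ha, hay⟩, rfl⟩
      simp only at hs0 hs1 hay
      have hga : g a = 1 := (hA ha).1.1
      have hgz : g ((s / h₀) • a) = s / h₀ := by
        rw [hg, wulffGauge_smul (by positivity), ← hg, hga, mul_one]
      refine ⟨(s / h₀) • a, ⟨?_, ?_⟩, ?_⟩
      · rw [← hg, hgz]
        exact ⟨by positivity, (div_lt_one hh₀p).2 hs1⟩
      · rw [← hg, hgz, smul_smul, inv_mul_cancel₀ (by positivity), one_smul]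
        exact ha
      · rw [hψT, hgz, hπsmul, hay, smul_smul]
        congr 4
        · rw [div_mul_div_cancel₀ hh₀p.ne', div_self hs0.ne', one_smul]
        · field_simp
  have hvol : volume (ψ '' P) = ENNReal.ofReal (1 / (k + 1)) * c * (ENNReal.ofReal h₀ *
      Measure.hausdorffMeasure (k : ℝ) (π '' A)) := by
    rw [himg, volume_image_linearIsometryEquiv_prod T (measurableSet_flatCone hBm h₀),
      volume_flatCone finrank_euclideanSpace_fin hBm hh₀p, hcF, Measure.smul_apply, smul_eq_mul,
      div_eq_mul_one_div, ENNReal.ofReal_mul hh₀p.le]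
    ring
  have hup := volume_image_le_of_lipschitzOn hE hψlip
  have hlo := volume_le_image_of_antilipschitzOn hE hψanti
  have hBA : Measure.hausdorffMeasure (k : ℝ) (π '' A) ≤ Measure.hausdorffMeasure (k : ℝ) A := by
    simpa using hπlip.hausdorffMeasure_image_le (d := (k : ℝ)) (by positivity)
  have hAB : Measure.hausdorffMeasure (k : ℝ) A ≤
      (K : ℝ≥0∞) ^ k * Measure.hausdorffMeasure (k : ℝ) (π '' A) := by
    simpa using hausdorffMeasure_le_image_of_antilipschitzOn hπanti (d := (k : ℝ)) (by positivity)
  have hKE : (1 : ℝ≥0∞) ≤ K := by exact_mod_cast hK.le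
  set I := ∫⁻ x in A, ENNReal.ofReal (H (wulffNormal H x)) ∂(Measure.hausdorffMeasure (k : ℝ))
  have hI1 : I ≤ K * ENNReal.ofReal h₀ * Measure.hausdorffMeasure (k : ℝ) A := by
    calc I ≤ ∫⁻ x in A, ENNReal.ofReal (K * h₀) ∂(Measure.hausdorffMeasure (k : ℝ)) := by
          refine setLIntegral_mono' hAm fun a ha => ENNReal.ofReal_le_ofReal ?_
          exact ((hA ha).2 _ (isNormalDir_wulffNormal hc hp a)).2.1.le
      _ = _ := by
          rw [setLIntegral_const, ENNReal.ofReal_mul hK0.le, ENNReal.ofReal_coe_nnreal]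
  have hI2 : ENNReal.ofReal h₀ * Measure.hausdorffMeasure (k : ℝ) A ≤ K * I := by
    calc _ = ∫⁻ x in A, ENNReal.ofReal h₀ ∂(Measure.hausdorffMeasure (k : ℝ)) := by
          rw [setLIntegral_const]
      _ ≤ ∫⁻ x in A, K * ENNReal.ofReal (H (wulffNormal H x))
          ∂(Measure.hausdorffMeasure (k : ℝ)) := by
          refine setLIntegral_mono' hAm fun a ha => ?_
          rw [← ENNReal.ofReal_coe_nnreal, ← ENNReal.ofReal_mul hK0.le]
          exact ENNReal.ofReal_le_ofReal
            ((hA ha).2 _ (isNormalDir_wulffNormal hc hp a)).2.2.le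
      _ = _ := lintegral_const_mul' _ _ ENNReal.coe_ne_top
  set κ := ENNReal.ofReal (1 / ((k : ℝ) + 1)) * c
  rw [hvol] at hup hlo
  constructor
  · calc κ * I ≤ κ * (K * ENNReal.ofReal h₀ *
          ((K : ℝ≥0∞) ^ k * Measure.hausdorffMeasure (k : ℝ) (π '' A))) := by
          gcongr
          exact hI1.trans (by gcongr)
      _ = (K : ℝ≥0∞) ^ (k + 1) * (κ * (ENNReal.ofReal h₀ *
          Measure.hausdorffMeasure (k : ℝ) (π '' A))) := by ring
      _ ≤ (K : ℝ≥0∞) ^ (k + 1) * ((K : ℝ≥0∞) ^ (k + 1) * volume P) := by gcongr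
      _ = _ := by ring
  · calc volume P ≤ (K : ℝ≥0∞) ^ (k + 1) * (κ * (ENNReal.ofReal h₀ *
          Measure.hausdorffMeasure (k : ℝ) (π '' A))) := hlo
      _ ≤ (K : ℝ≥0∞) ^ (k + 1) * (κ * (K * I)) := by
          gcongr _ * (_ * ?_)
          exact le_trans (by gcongr) hI2
      _ = (K : ℝ≥0∞) ^ (k + 2) * (κ * I) := by ring
      _ ≤ _ := by
          gcongr 1
          -- Here only K^(k+2) is needed, since the projection does not increase Hausdorff measure.
          exact pow_le_pow_right₀ hKE (by omega)

/-- The image of Lebesgue measure on the open Wulff shape under radial projection to its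
boundary. -/
def coneMeasure (H : sphere (0 : E) 1 → ℝ) : Measure E :=
  (volume.restrict {z | wulffGauge H z ∈ Ioo 0 1}).map fun z => (wulffGauge H z)⁻¹ • z

theorem coneMeasure_apply [Nontrivial E] (hc : Continuous H) (hp : ∀ v, 0 < H v)
    {A : Set E} (hA : MeasurableSet A) : coneMeasure H A = volume (radialCone H A) := by
  rw [coneMeasure, Measure.map_apply (measurable_inv_wulffGauge_smul hc hp) hA,
    Measure.restrict_apply (measurable_inv_wulffGauge_smul hc hp hA), inter_comm]
  rfl

theorem le_of_forall_le_pow_mul {a b : ℝ≥0∞} (m : ℕ)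
    (h : ∀ K : NNReal, 1 < K → a ≤ (K : ℝ≥0∞) ^ m * b) : a ≤ b := by
  have h1 : Tendsto (fun K : NNReal => (K : ℝ≥0∞) ^ m * b) (𝓝[>] 1) (𝓝 (((1 : NNReal) : ℝ≥0∞) ^ m * b)) := by
    refine ENNReal.Tendsto.mul_const ?_ (Or.inl (by simp))
    exact ((ENNReal.continuous_pow m).comp ENNReal.continuous_coe).continuousAt.mono_left
      nhdsWithin_le_nhds
  simp only [ENNReal.coe_one, one_pow, one_mul] at h1
  exact ge_of_tendsto h1 (eventually_mem_nhdsWithin.mono fun K hK => h K hK)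

/-- The cone measure of a Wulff shape is a fixed multiple of the support function times surface
measure on the regular boundary. -/
theorem exists_coneMeasure_eq [Nontrivial E] {k : ℕ} (hE : Module.finrank ℝ E = k + 1) :
    ∃ κ : ℝ≥0∞, κ ≠ 0 ∧ κ ≠ ∞ ∧ ∀ H : sphere (0 : E) 1 → ℝ, Continuous H → (∀ v, 0 < H v) →
      ((Measure.hausdorffMeasure (k : ℝ)).restrict (wulffRegularBoundary H)).withDensity
        (fun x => κ * ENNReal.ofReal (H (wulffNormal H x))) =
      (coneMeasure H).restrict (wulffRegularBoundary H) := by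
  obtain ⟨c, hc0, hct, hcF⟩ := exists_volume_eq_smul_hausdorffMeasure
    (E := EuclideanSpace ℝ (Fin k)) (d := k) finrank_euclideanSpace_fin
  have hκ0 : ENNReal.ofReal (1 / ((k : ℝ) + 1)) * c ≠ 0 :=
    mul_ne_zero (by simp; positivity) hc0
  have hκt : ENNReal.ofReal (1 / ((k : ℝ) + 1)) * c ≠ ∞ :=
    ENNReal.mul_ne_top ENNReal.ofReal_ne_top hct
  refine ⟨_, hκ0, hκt, fun H hc hp => ?_⟩
  set κ := ENNReal.ofReal (1 / ((k : ℝ) + 1)) * c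
  set R := wulffRegularBoundary H with hR
  have hRm : MeasurableSet R := measurableSet_wulffRegularBoundary hc hp
  set m₁ := ((Measure.hausdorffMeasure (k : ℝ)).restrict R).withDensity
    (fun x => κ * ENNReal.ofReal (H (wulffNormal H x))) with hm₁
  have h1 : ∀ A ⊆ R, MeasurableSet A → m₁ A = κ * ∫⁻ x in A, ENNReal.ofReal (H (wulffNormal H x))
      ∂(Measure.hausdorffMeasure (k : ℝ)) := fun A hA hAm => by
    rw [hm₁, withDensity_apply _ hAm, Measure.restrict_restrict hAm, inter_eq_left.2 hA,
      lintegral_const_mul' _ _ hκt]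
  -- The local comparison globalises with the same factor; letting K decrease to 1 then gives
  -- equality.
  have key : ∀ K : NNReal, 1 < K → ∀ A ⊆ R, MeasurableSet A →
      m₁ A ≤ (K : ℝ≥0∞) ^ (2 * k + 2) * coneMeasure H A ∧
      coneMeasure H A ≤ (K : ℝ≥0∞) ^ (2 * k + 2) * m₁ A := by
    intro K hK A hA hAm
    constructor
    · refine measure_le_of_locally_le (μ := m₁) (ν := (K : ℝ≥0∞) ^ (2 * k + 2) • coneMeasure H)
        (fun x hx => ?_) hA hAm
      obtain ⟨V, hV, h⟩ := exists_nhds_radialCone_comparison hE hc hp hcF hx hK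
      refine ⟨V, hV, fun B hB hBm => ?_⟩
      rw [h1 B (hB.trans inter_subset_left) hBm, Measure.smul_apply, smul_eq_mul,
        coneMeasure_apply hc hp hBm]
      exact (h B hB hBm).1
    · refine measure_le_of_locally_le (μ := coneMeasure H) (ν := (K : ℝ≥0∞) ^ (2 * k + 2) • m₁)
        (fun x hx => ?_) hA hAm
      obtain ⟨V, hV, h⟩ := exists_nhds_radialCone_comparison hE hc hp hcF hx hK
      refine ⟨V, hV, fun B hB hBm => ?_⟩
      rw [Measure.smul_apply, smul_eq_mul, h1 B (hB.trans inter_subset_left) hBm,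
        coneMeasure_apply hc hp hBm]
      exact (h B hB hBm).2
  refine Measure.ext fun A hAm => ?_
  have h2 : m₁ A = m₁ (A ∩ R) := by
    rw [hm₁, withDensity_apply _ hAm, withDensity_apply _ (hAm.inter hRm),
      Measure.restrict_restrict hAm, Measure.restrict_restrict (hAm.inter hRm), inter_assoc,
      inter_self]
  rw [h2, Measure.restrict_apply hAm]
  exact le_antisymm
    (le_of_forall_le_pow_mul _ fun K hK => (key K hK _ inter_subset_right (hAm.inter hRm)).1)
    (le_of_forall_le_pow_mul _ fun K hK => (key K hK _ inter_subset_right (hAm.inter hRm)).2)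

end AreaFormula

/-! ### Polar coordinates -/

section Polar

variable {E : Type*} [NormedAddCommGroup E] [InnerProductSpace ℝ E] [FiniteDimensional ℝ E]
  [MeasurableSpace E] [BorelSpace E] {H : sphere (0 : E) 1 → ℝ}

theorem lintegral_eq_lintegral_toSphere [Nontrivial E] {f : E → ℝ≥0∞} (hf : Measurable f) :
    ∫⁻ z, f z = ∫⁻ u : sphere (0 : E) 1, (∫⁻ r in Ioi (0 : ℝ),
      ENNReal.ofReal (r ^ (Module.finrank ℝ E - 1)) * f (r • (u : E)))
        ∂(volume : Measure E).toSphere := by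
  have h1 := (volume : Measure E).measurePreserving_homeomorphUnitSphereProd.symm
    (homeomorphUnitSphereProd E).toMeasurableEquiv
  have hfs : Measurable fun x : sphere (0 : E) 1 × Ioi (0 : ℝ) => f ((x.2 : ℝ) • (x.1 : E)) := by
    fun_prop
  calc ∫⁻ z, f z = ∫⁻ z in ({0}ᶜ : Set E), f z := by rw [restrict_compl_singleton]
    _ = ∫⁻ z : ({0}ᶜ : Set E), f z ∂((volume : Measure E).comap (↑)) :=
        (lintegral_subtype_comap (measurableSet_singleton _).compl f).symm
    _ = ∫⁻ x : sphere (0 : E) 1 × Ioi (0 : ℝ), f ((x.2 : ℝ) • (x.1 : E))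
          ∂((volume : Measure E).toSphere.prod (.volumeIoiPow (Module.finrank ℝ E - 1))) := by
        rw [← h1.map_eq, lintegral_map_equiv]
        rfl
    _ = ∫⁻ u : sphere (0 : E) 1, ∫⁻ r : Ioi (0 : ℝ), f ((r : ℝ) • (u : E))
          ∂(.volumeIoiPow (Module.finrank ℝ E - 1)) ∂(volume : Measure E).toSphere :=
        lintegral_prod _ hfs.aemeasurable
    _ = _ := by
        refine lintegral_congr fun u => ?_
        rw [Measure.volumeIoiPow, lintegral_withDensity_eq_lintegral_mul _ (by fun_prop)
          (by fun_prop), ← lintegral_subtype_comap measurableSet_Ioi]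
        rfl

/-- The spherical measure of a set is a multiple of the volume of the cone over it, and irregularity
is invariant under positive scaling. -/
theorem ae_toSphere_mem_regularDirs [Nontrivial E] (hc : Continuous H) (hp : ∀ v, 0 < H v) :
    ∀ᵐ u : sphere (0 : E) 1 ∂(volume : Measure E).toSphere, (u : E) ∈ regularDirs H := by
  have hm : MeasurableSet {u : sphere (0 : E) 1 | (u : E) ∉ regularDirs H} :=
    (measurable_subtype_coe (measurableSet_regularDirs hc hp)).compl
  rw [ae_iff, Measure.toSphere_apply' _ hm]
  have h0 : volume (regularDirs H)ᶜ = 0 := ae_iff.1 (ae_mem_regularDirs hc hp volume)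
  rw [measure_mono_null ?_ h0, mul_zero]
  rintro _ ⟨r, hr, _, ⟨u, hu, rfl⟩, rfl⟩
  exact fun hc => hu ((smul_mem_regularDirs_iff hr.1).1 hc)

theorem sphere_coe_ne_zero (u : sphere (0 : E) 1) : (u : E) ≠ 0 := by
  intro h
  have := norm_sphere_coe u
  simp [h] at this

theorem wulffGauge_sphere_pos (hc : Continuous H) (hp : ∀ v, 0 < H v) (u : sphere (0 : E) 1) :
    0 < wulffGauge H (u : E) :=
  wulffGauge_pos hc hp (sphere_coe_ne_zero u)

theorem continuous_wulffGauge_sphere [Nontrivial E] (hc : Continuous H) (hp : ∀ v, 0 < H v) :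
    Continuous fun u : sphere (0 : E) 1 => wulffGauge H (u : E) :=
  (continuous_wulffGauge hc hp).comp continuous_subtype_val

theorem continuous_inv_wulffGauge_sphere [Nontrivial E] (hc : Continuous H) (hp : ∀ v, 0 < H v) :
    Continuous fun u : sphere (0 : E) 1 => (wulffGauge H (u : E))⁻¹ :=
  (continuous_wulffGauge_sphere hc hp).inv₀ fun u => (wulffGauge_sphere_pos hc hp u).ne'

/-- On the ray through u the radial projection is constant, so only ∫ r^k dr over (0, ρ) remains,
with ρ the inverse of the gauge at u. -/
theorem lintegral_coneMeasure [Nontrivial E] {k : ℕ} (hE : Module.finrank ℝ E = k + 1)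
    (hc : Continuous H) (hp : ∀ v, 0 < H v) {G : E → ℝ≥0∞} (hG : Measurable G) :
    ∫⁻ x, G x ∂(coneMeasure H) = ∫⁻ u : sphere (0 : E) 1,
      ENNReal.ofReal ((wulffGauge H (u : E))⁻¹ ^ (k + 1) / (k + 1)) *
        G ((wulffGauge H (u : E))⁻¹ • (u : E)) ∂(volume : Measure E).toSphere := by
  have hgm := (continuous_wulffGauge hc hp).measurable
  have hrad := measurable_inv_wulffGauge_smul hc hp
  have hS : MeasurableSet {z | wulffGauge H z ∈ Ioo 0 1} := hgm measurableSet_Ioo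
  rw [coneMeasure, lintegral_map hG hrad, ← lintegral_indicator hS,
    lintegral_eq_lintegral_toSphere (Measurable.indicator (by exact hG.comp hrad) hS)]
  refine lintegral_congr fun u => ?_
  set a := wulffGauge H (u : E) with ha
  have hap : 0 < a := wulffGauge_sphere_pos hc hp u
  have h1 : ∀ r ∈ Ioi (0 : ℝ), ENNReal.ofReal (r ^ (Module.finrank ℝ E - 1)) *
      ({z | wulffGauge H z ∈ Ioo 0 1}.indicator
        (fun z => G ((wulffGauge H z)⁻¹ • z)) (r • (u : E))) =
      (Ioo 0 a⁻¹).indicator (fun r => ENNReal.ofReal (r ^ k) * G (a⁻¹ • (u : E))) r := by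
    intro r hr
    have hr' : (0 : ℝ) < r := hr
    have hg : wulffGauge H (r • (u : E)) = r * a := wulffGauge_smul hr'.le _
    by_cases hra : r < a⁻¹
    · have h2 : r * a < 1 := by rwa [← lt_div_iff₀ hap, one_div]
      have hmem : r • (u : E) ∈ {z | wulffGauge H z ∈ Ioo 0 1} := by
        rw [mem_ofPred_eq, hg]
        exact ⟨by positivity, h2⟩
      rw [indicator_of_mem hmem, indicator_of_mem (show r ∈ Ioo 0 a⁻¹ from ⟨hr', hra⟩), hg, hE, smul_smul]
      congr 3
      field_simp
    · have hmem : r • (u : E) ∉ {z | wulffGauge H z ∈ Ioo 0 1} := by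
        rw [mem_ofPred_eq, hg]
        rintro ⟨-, h2⟩
        exact hra (by rwa [← lt_div_iff₀ hap, one_div] at h2)
      rw [indicator_of_notMem hmem, indicator_of_notMem (fun h => hra h.2), mul_zero]
  rw [setLIntegral_congr_fun measurableSet_Ioi h1, lintegral_indicator measurableSet_Ioo,
    Measure.restrict_restrict measurableSet_Ioo, inter_eq_left.2 Ioo_subset_Ioi_self,
    lintegral_mul_const _ (by fun_prop)]
  congr 1
  rw [setLIntegral_congr Ioo_ae_eq_Ioc, ← ofReal_integral_eq_lintegral_ofReal]
  · congr 1
    rw [← intervalIntegral.integral_of_le (by positivity), integral_pow]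
    simp
  · exact (Continuous.integrableOn_Icc (by fun_prop)).mono_set Ioc_subset_Icc_self
  · filter_upwards [ae_restrict_mem measurableSet_Ioc] with y hy
    exact pow_nonneg hy.1.le _

/-- The measure whose value on a star body is its Gaussian dual quermassintegral. -/
def gaussDualMeasure (E : Type*) [NormedAddCommGroup E] [InnerProductSpace ℝ E]
    [FiniteDimensional ℝ E] [MeasurableSpace E] [BorelSpace E] (q : ℝ) : Measure E :=
  volume.withDensity fun z =>
    ENNReal.ofReal (‖z‖ ^ (q - (Module.finrank ℝ E : ℝ)) * Real.exp (-(‖z‖ ^ 2) / 2))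

/-- The radial primitive of the density of `gaussDualMeasure`. -/
def radialPrimitive (q r : ℝ) : ℝ := ∫ s in (0 : ℝ)..r, s ^ (q - 1) * Real.exp (-(s ^ 2) / 2)

theorem intervalIntegrable_radialDensity {q : ℝ} (hq : 0 < q) (a b : ℝ) :
    IntervalIntegrable (fun s : ℝ => s ^ (q - 1) * Real.exp (-(s ^ 2) / 2)) volume a b :=
  (intervalIntegral.intervalIntegrable_rpow' (by linarith)).mul_continuousOn (by fun_prop)

theorem continuous_radialPrimitive {q : ℝ} (hq : 0 < q) : Continuous (radialPrimitive q) :=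
  intervalIntegral.continuous_primitive (intervalIntegrable_radialDensity hq) 0

theorem hasDerivAt_radialPrimitive {q r : ℝ} (hq : 0 < q) (hr : 0 < r) :
    HasDerivAt (radialPrimitive q) (r ^ (q - 1) * Real.exp (-(r ^ 2) / 2)) r := by
  have hcont : ContinuousAt (fun s : ℝ => s ^ (q - 1) * Real.exp (-(s ^ 2) / 2)) r :=
    (Real.continuousAt_rpow_const _ _ (Or.inl hr.ne')).mul (by fun_prop)
  refine intervalIntegral.integral_hasDerivAt_right (intervalIntegrable_radialDensity hq 0 r) ?_
    hcont
  exact (Measurable.stronglyMeasurable (by fun_prop)).stronglyMeasurableAtFilter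

theorem radialPrimitive_nonneg {q r : ℝ} (hr : 0 ≤ r) : 0 ≤ radialPrimitive q r :=
  intervalIntegral.integral_nonneg hr fun s hs => by
    have := hs.1
    positivity

theorem radialPrimitive_pos {q r : ℝ} (hq : 0 < q) (hr : 0 < r) : 0 < radialPrimitive q r :=
  intervalIntegral.intervalIntegral_pos_of_pos_on (intervalIntegrable_radialDensity hq 0 r)
    (fun s hs => by have := hs.1; positivity) hr

/-- The Jacobian r^(n-1) turns the singular weight r^(q-n) into r^(q-1), which is integrable at 0
exactly because q > 0. -/
theorem gaussDualMeasure_wulffShape [Nontrivial E] {q : ℝ} (hq : 0 < q)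
    (hc : Continuous H) (hp : ∀ v, 0 < H v) :
    gaussDualMeasure E q (wulffShape H) = ENNReal.ofReal (∫ u : sphere (0 : E) 1,
      radialPrimitive q (wulffGauge H (u : E))⁻¹ ∂(volume : Measure E).toSphere) := by
  have hSm : MeasurableSet (wulffShape H) := wulffShape_isClosed.measurableSet
  have hcont : Continuous fun u : sphere (0 : E) 1 =>
      radialPrimitive q (wulffGauge H (u : E))⁻¹ :=
    (continuous_radialPrimitive hq).comp (continuous_inv_wulffGauge_sphere hc hp)
  have hint : Integrable (fun u : sphere (0 : E) 1 => radialPrimitive q (wulffGauge H (u : E))⁻¹)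
      (volume : Measure E).toSphere := by
    have := hcont.continuousOn.integrableOn_compact (μ := (volume : Measure E).toSphere)
      isCompact_univ
    rwa [integrableOn_univ] at this
  rw [ofReal_integral_eq_lintegral_ofReal hint (Eventually.of_forall fun u =>
      radialPrimitive_nonneg (inv_nonneg.2 (wulffGauge_sphere_pos hc hp u).le)),
    gaussDualMeasure, withDensity_apply _ hSm, ← lintegral_indicator hSm,
    lintegral_eq_lintegral_toSphere (Measurable.indicator (by fun_prop) hSm)]
  refine lintegral_congr fun u => ?_
  set a := wulffGauge H (u : E) with ha
  have hap : 0 < a := wulffGauge_sphere_pos hc hp u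
  have hn : 1 ≤ Module.finrank ℝ E := Module.finrank_pos
  have h1 : ∀ r ∈ Ioi (0 : ℝ), ENNReal.ofReal (r ^ (Module.finrank ℝ E - 1)) *
      ((wulffShape H).indicator (fun z => ENNReal.ofReal
        (‖z‖ ^ (q - (Module.finrank ℝ E : ℝ)) * Real.exp (-(‖z‖ ^ 2) / 2))) (r • (u : E))) =
      (Ioc 0 a⁻¹).indicator
        (fun r => ENNReal.ofReal (r ^ (q - 1) * Real.exp (-(r ^ 2) / 2))) r := by
    intro r hr
    have hr' : (0 : ℝ) < r := hr
    have hg : wulffGauge H (r • (u : E)) = r * a := wulffGauge_smul hr'.le _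
    have hiff : r • (u : E) ∈ wulffShape H ↔ r ≤ a⁻¹ := by
      rw [mem_wulffShape_iff hc hp, hg, ← le_div_iff₀ hap, one_div]
    by_cases hra : r ≤ a⁻¹
    · rw [indicator_of_mem (hiff.2 hra), indicator_of_mem (show r ∈ Ioc 0 a⁻¹ from ⟨hr', hra⟩),
        ← ENNReal.ofReal_mul (by positivity), norm_smul, norm_sphere_coe, mul_one,
        Real.norm_of_nonneg hr'.le, ← mul_assoc, ← Real.rpow_natCast, ← Real.rpow_add hr',
        Nat.cast_sub hn]
      congr 3
      push_cast
      ring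
    · rw [indicator_of_notMem (fun h => hra (hiff.1 h)), indicator_of_notMem (fun h => hra h.2),
        mul_zero]
  rw [setLIntegral_congr_fun measurableSet_Ioi h1, lintegral_indicator measurableSet_Ioc,
    Measure.restrict_restrict measurableSet_Ioc, inter_eq_left.2 Ioc_subset_Ioi_self,
    radialPrimitive, intervalIntegral.integral_of_le (by positivity),
    ofReal_integral_eq_lintegral_ofReal]
  · exact (intervalIntegrable_radialDensity hq 0 a⁻¹).1
  · filter_upwards [ae_restrict_mem measurableSet_Ioc] with y hy
    have := hy.1
    simp only [Pi.zero_apply]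
    positivity

end Polar

/-! ### First variations -/

section Variation

variable {E : Type*} [NormedAddCommGroup E] [InnerProductSpace ℝ E] [FiniteDimensional ℝ E]
  {H φ : sphere (0 : E) 1 → ℝ}

/-- The logarithmic variation of `H` in the direction `φ`. -/
def logVariation (H φ : sphere (0 : E) 1 → ℝ) (t : ℝ) (v : sphere (0 : E) 1) : ℝ :=
  H v * Real.exp (t * φ v)

theorem logVariation_zero : logVariation H φ 0 = H := by
  ext v; simp [logVariation]

theorem continuous_logVariation (hc : Continuous H) (hφ : Continuous φ) (t : ℝ) :
    Continuous (logVariation H φ t) := by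
  unfold logVariation; fun_prop

theorem logVariation_pos (hp : ∀ v, 0 < H v) (t : ℝ) (v : sphere (0 : E) 1) :
    0 < logVariation H φ t v :=
  mul_pos (hp v) (Real.exp_pos _)

/-- The logarithm of the gauge of u at time t is the supremum, over v with ⟨u,v⟩ > 0, of affine
functions of t with slope -φ(v). A direction optimal at time t is tested at time s. -/
theorem log_wulffGauge_logVariation_ge (hc : Continuous H) (hp : ∀ v, 0 < H v)
    (hφ : Continuous φ) {u : E} (hu : u ≠ 0) {t : ℝ} {v : sphere (0 : E) 1}
    (hv : IsNormalDir (logVariation H φ t) u v) (s : ℝ) :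
    Real.log (wulffGauge (logVariation H φ t) u) + (t - s) * φ v ≤
      Real.log (wulffGauge (logVariation H φ s) u) := by
  have ht := wulffGauge_pos (continuous_logVariation hc hφ t) (logVariation_pos hp t) hu
  have h1 := inner_div_le_wulffGauge (continuous_logVariation hc hφ s) (logVariation_pos hp s) u v
  rw [show inner ℝ u (v : E) = wulffGauge (logVariation H φ t) u * logVariation H φ t v from hv]
    at h1
  have h2 : wulffGauge (logVariation H φ t) u * logVariation H φ t v / logVariation H φ s v =
      wulffGauge (logVariation H φ t) u * Real.exp ((t - s) * φ v) := by
    simp only [logVariation]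
    rw [sub_mul, Real.exp_sub]
    have := (hp v).ne'
    field_simp
  rw [h2] at h1
  have h3 := Real.log_le_log (by positivity) h1
  rwa [Real.log_mul ht.ne' (Real.exp_pos _).ne', Real.log_exp] at h3

/-- The slopes are bounded by C uniformly in u; this dominates the difference quotients when
differentiating under the integral. -/
theorem abs_log_wulffGauge_logVariation_sub_le [Nontrivial E] (hc : Continuous H)
    (hp : ∀ v, 0 < H v) (hφ : Continuous φ) {C : ℝ} (hC : ∀ v, |φ v| ≤ C) {u : E} (hu : u ≠ 0)
    (s t : ℝ) : |Real.log (wulffGauge (logVariation H φ s) u) -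
      Real.log (wulffGauge (logVariation H φ t) u)| ≤ C * |s - t| := by
  have key : ∀ s t : ℝ, Real.log (wulffGauge (logVariation H φ t) u) -
      Real.log (wulffGauge (logVariation H φ s) u) ≤ C * |s - t| := by
    intro s t
    obtain ⟨v, hv⟩ := exists_isNormalDir (continuous_logVariation hc hφ t)
      (logVariation_pos hp t) u
    have h1 := log_wulffGauge_logVariation_ge hc hp hφ hu hv s
    have h2 : -((t - s) * φ v) ≤ C * |s - t| := by
      refine (neg_le_abs _).trans ?_
      rw [abs_mul, mul_comm, abs_sub_comm]
      gcongr
      exact hC v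
    linarith
  rw [abs_sub_le_iff]
  refine ⟨?_, key s t⟩
  rw [abs_sub_comm s t]
  exact key t s

theorem continuous_wulffGauge_logVariation [Nontrivial E] (hc : Continuous H)
    (hp : ∀ v, 0 < H v) (hφ : Continuous φ) {u : E} (hu : u ≠ 0) :
    Continuous fun t => wulffGauge (logVariation H φ t) u := by
  obtain ⟨C, hC⟩ := isCompact_univ.exists_bound_of_continuousOn hφ.continuousOn
  have h1 : LipschitzWith (Real.toNNReal C)
      fun t => Real.log (wulffGauge (logVariation H φ t) u) :=
    LipschitzWith.of_dist_le_mul fun s t => by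
      rw [Real.dist_eq, Real.dist_eq]
      refine (abs_log_wulffGauge_logVariation_sub_le hc hp hφ
        (fun v => hC v (mem_univ v)) hu s t).trans ?_
      gcongr
      exact Real.le_coe_toNNReal C
  have h2 := Real.continuous_exp.comp h1.continuous
  convert h2 using 2 with t
  exact (Real.exp_log (wulffGauge_pos (continuous_logVariation hc hφ t)
    (logVariation_pos hp t) hu)).symm

/-- Envelope theorem. With v optimal at time t and v₀ at time 0, the increment lies between -tφ(v₀)
and -tφ(v); uniqueness of v₀ and hemicontinuity force φ(v) → φ(v₀). -/
theorem hasDerivAt_log_wulffGauge_logVariation [Nontrivial E] (hc : Continuous H)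
    (hp : ∀ v, 0 < H v) (hφ : Continuous φ) {u : E} (hu : u ∈ regularDirs H) :
    HasDerivAt (fun t => Real.log (wulffGauge (logVariation H φ t) u))
      (-φ (wulffNormal H u)) 0 := by
  set v₀ := wulffNormal H u with hv₀
  have hu0 := hu.1
  have hclosed : IsClosed {a : ℝ × sphere (0 : E) 1 | IsNormalDir (logVariation H φ a.1) u a.2} := by
    refine isClosed_eq (continuous_const.inner (continuous_subtype_val.comp continuous_snd))
      (((continuous_wulffGauge_logVariation hc hp hφ hu0).comp continuous_fst).mul ?_)
    unfold logVariation
    fun_prop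
  rw [hasDerivAt_iff_isLittleO, Asymptotics.isLittleO_iff]
  intro ε hε
  have hW : IsOpen {v | |φ v - φ v₀| < ε} := isOpen_lt (by fun_prop) continuous_const
  have hev := eventually_forall_mem_of_isClosed (P := fun t v => IsNormalDir (logVariation H φ t) u v)
    hclosed hW (x₀ := 0) (fun v hv => by
      rw [logVariation_zero] at hv
      rw [← wulffNormal_eq hc hp hu hv, ← hv₀]
      simpa using hε)
  filter_upwards [hev] with t ht
  obtain ⟨v, hv⟩ := exists_isNormalDir (continuous_logVariation hc hφ t)
    (logVariation_pos hp t) u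
  have h1 := log_wulffGauge_logVariation_ge hc hp hφ hu0 hv 0
  have h2 := log_wulffGauge_logVariation_ge hc hp hφ hu0 (t := 0) (v := v₀)
    (by rw [logVariation_zero]; exact isNormalDir_wulffNormal hc hp u) t
  have h3 : |φ v - φ v₀| < ε := ht v hv
  simp only [sub_zero, zero_sub, smul_eq_mul, Real.norm_eq_abs] at h1 h2 ⊢
  set a := Real.log (wulffGauge (logVariation H φ t) u)
  set b := Real.log (wulffGauge (logVariation H φ 0) u)
  have h4 : |t * (φ v - φ v₀)| ≤ ε * |t| := by
    rw [abs_mul, mul_comm]; gcongr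
  rw [abs_le] at h4 ⊢
  constructor <;> linarith [h4.1, h4.2]

variable [MeasurableSpace E] [BorelSpace E]

theorem integrable_of_continuous {X : Type*} [TopologicalSpace X] [CompactSpace X]
    [MeasurableSpace X] [OpensMeasurableSpace X] [T2Space X] [SecondCountableTopology X]
    {μ : Measure X} [IsFiniteMeasure μ] {f : X → ℝ} (hf : Continuous f) : Integrable f μ := by
  obtain ⟨C, hC⟩ := isCompact_univ.exists_bound_of_continuousOn hf.continuousOn
  exact Integrable.of_bound hf.aestronglyMeasurable C (Eventually.of_forall fun x => hC x (mem_univ x))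

theorem hasDerivAt_radialPrimitive_exp {q : ℝ} (hq : 0 < q) (τ : ℝ) :
    HasDerivAt (fun τ => radialPrimitive q (Real.exp (-τ)))
      (-(Real.exp (-τ) ^ q * Real.exp (-(Real.exp (-τ) ^ 2) / 2))) τ := by
  have h1 := (hasDerivAt_radialPrimitive hq (Real.exp_pos (-τ))).comp τ
    ((Real.hasDerivAt_exp (-τ)).comp τ (hasDerivAt_neg τ))
  refine h1.congr_deriv ?_
  have : Real.exp (-τ) ^ q = Real.exp (-τ) ^ (q - 1) * Real.exp (-τ) := by
    rw [← Real.rpow_add_one (Real.exp_pos _).ne']; ring_nf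
  rw [this]
  ring

/-- The normal is continuous on the regular directions, which have full measure; nothing is known of
it elsewhere. -/
theorem aemeasurable_wulffNormal_sphere [Nontrivial E] (hc : Continuous H) (hp : ∀ v, 0 < H v) :
    AEMeasurable (fun u : sphere (0 : E) 1 => wulffNormal H (u : E))
      (volume : Measure E).toSphere := by
  have hm : MeasurableSet {u : sphere (0 : E) 1 | (u : E) ∈ regularDirs H} :=
    measurable_subtype_coe (measurableSet_regularDirs hc hp)
  rw [← Measure.restrict_eq_self_of_ae_mem (s := {u : sphere (0 : E) 1 | (u : E) ∈ regularDirs H})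
    (ae_toSphere_mem_regularDirs hc hp)]
  exact ((continuousOn_wulffNormal hc hp).comp continuous_subtype_val.continuousOn
    (fun u hu => hu)).aemeasurable hm

theorem continuous_radialWeight [Nontrivial E] {q : ℝ} (hq : 0 < q) (hc : Continuous H)
    (hp : ∀ v, 0 < H v) : Continuous fun u : sphere (0 : E) 1 =>
      (wulffGauge H (u : E))⁻¹ ^ q * Real.exp (-((wulffGauge H (u : E))⁻¹ ^ 2) / 2) := by
  have h := continuous_inv_wulffGauge_sphere hc hp
  exact (h.rpow_const fun _ => Or.inr hq.le).mul (by fun_prop)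

/-- First variation of the Gaussian dual quermassintegral of a Wulff shape. -/
theorem hasDerivAt_integral_radialPrimitive [Nontrivial E] {q : ℝ} (hq : 0 < q)
    (hc : Continuous H) (hp : ∀ v, 0 < H v) (hφ : Continuous φ) :
    HasDerivAt (fun t => ∫ u : sphere (0 : E) 1,
        radialPrimitive q (wulffGauge (logVariation H φ t) (u : E))⁻¹
          ∂(volume : Measure E).toSphere)
      (∫ u : sphere (0 : E) 1, (wulffGauge H (u : E))⁻¹ ^ q *
        Real.exp (-((wulffGauge H (u : E))⁻¹ ^ 2) / 2) * φ (wulffNormal H (u : E))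
          ∂(volume : Measure E).toSphere) 0 := by
  obtain ⟨C, hC'⟩ := isCompact_univ.exists_bound_of_continuousOn hφ.continuousOn
  have hC : ∀ v, |φ v| ≤ C := fun v => hC' v (mem_univ v)
  have hpos : ∀ t (u : sphere (0 : E) 1), 0 < wulffGauge (logVariation H φ t) (u : E) :=
    fun t u => wulffGauge_sphere_pos (continuous_logVariation hc hφ t) (logVariation_pos hp t) u
  have hinv : ∀ t (u : sphere (0 : E) 1), (wulffGauge (logVariation H φ t) (u : E))⁻¹ =
      Real.exp (-Real.log (wulffGauge (logVariation H φ t) (u : E))) := fun t u => by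
    rw [Real.exp_neg, Real.exp_log (hpos t u)]
  have hlogc : Continuous fun u : sphere (0 : E) 1 => Real.log (wulffGauge H (u : E)) :=
    (continuous_wulffGauge_sphere hc hp).log fun u => (wulffGauge_sphere_pos hc hp u).ne'
  obtain ⟨M, hM⟩ := isCompact_univ.exists_bound_of_continuousOn hlogc.continuousOn
  have hlogb : ∀ t ∈ ball (0 : ℝ) 1, ∀ u : sphere (0 : E) 1,
      |Real.log (wulffGauge (logVariation H φ t) (u : E))| ≤ M + C := fun t ht u => by
    have h1 := abs_log_wulffGauge_logVariation_sub_le hc hp hφ hC (sphere_coe_ne_zero u) t 0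
    rw [logVariation_zero, sub_zero] at h1
    have h2 : |Real.log (wulffGauge H (u : E))| ≤ M := hM u (mem_univ u)
    have h3 : |t| < 1 := by simpa using ht
    have h4 : C * |t| ≤ C := mul_le_of_le_one_right ((abs_nonneg _).trans (hC u)) h3.le
    have := abs_sub_abs_le_abs_sub (Real.log (wulffGauge (logVariation H φ t) (u : E)))
      (Real.log (wulffGauge H (u : E)))
    linarith
  -- L bounds the derivative in τ = log g, namely r^q exp(-r²/2) in absolute value with r = exp(-τ),
  -- since |τ| ≤ M + C when |t| < 1.
  set L : ℝ := Real.exp (M + C) ^ q with hL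
  have hLip : ∀ τ ∈ Icc (-(M + C)) (M + C), ∀ τ' ∈ Icc (-(M + C)) (M + C),
      |radialPrimitive q (Real.exp (-τ)) - radialPrimitive q (Real.exp (-τ'))| ≤ L * |τ - τ'| := by
    intro τ hτ τ' hτ'
    refine Convex.norm_image_sub_le_of_norm_hasDerivWithin_le
      (f := fun τ => radialPrimitive q (Real.exp (-τ)))
      (fun x _ => (hasDerivAt_radialPrimitive_exp hq x).hasDerivWithinAt) (fun x hx => ?_)
      (convex_Icc (-(M + C)) (M + C)) hτ' hτ
    rw [norm_neg, Real.norm_of_nonneg (by positivity)]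
    calc Real.exp (-x) ^ q * Real.exp (-(Real.exp (-x) ^ 2) / 2)
        ≤ Real.exp (M + C) ^ q * 1 := by
          gcongr
          · linarith [hx.1]
          · rw [Real.exp_le_one_iff]
            have := sq_nonneg (Real.exp (-x))
            linarith
      _ = L := mul_one _
  have hcontt : ∀ t, Continuous fun u : sphere (0 : E) 1 =>
      radialPrimitive q (wulffGauge (logVariation H φ t) (u : E))⁻¹ := fun t =>
    (continuous_radialPrimitive hq).comp
      (continuous_inv_wulffGauge_sphere (continuous_logVariation hc hφ t) (logVariation_pos hp t))
  refine (hasDerivAt_integral_of_dominated_loc_of_lip (bound := fun _ => L * C)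
    (ball_mem_nhds (0 : ℝ) one_pos) (Eventually.of_forall fun t => (hcontt t).aestronglyMeasurable)
    (integrable_of_continuous (hcontt 0)) ?_ (Eventually.of_forall fun u => ?_)
    (integrable_const _) ?_).2
  · refine ((continuous_radialWeight hq hc hp).aemeasurable.mul ?_).aestronglyMeasurable
    exact hφ.measurable.comp_aemeasurable (aemeasurable_wulffNormal_sphere hc hp)
  · refine LipschitzOnWith.of_dist_le_mul fun s hs t ht => ?_
    rw [Real.dist_eq, Real.dist_eq, hinv, hinv]
    have h1 := hLip _ (abs_le.1 (hlogb s hs u)) _ (abs_le.1 (hlogb t ht u))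
    have h2 := abs_log_wulffGauge_logVariation_sub_le hc hp hφ hC (sphere_coe_ne_zero u) s t
    calc _ ≤ L * (C * |s - t|) := h1.trans (by gcongr)
      _ ≤ (Real.nnabs (L * C) : ℝ) * |s - t| := by
        rw [← mul_assoc, Real.coe_nnabs]
        gcongr
        exact le_abs_self _
  · filter_upwards [ae_toSphere_mem_regularDirs hc hp] with u hu
    have h1 := (hasDerivAt_radialPrimitive_exp hq
      (Real.log (wulffGauge (logVariation H φ 0) (u : E)))).comp 0
      (hasDerivAt_log_wulffGauge_logVariation hc hp hφ hu)
    simp only [hinv]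
    refine h1.congr_deriv ?_
    rw [← hinv, logVariation_zero]
    ring

theorem hasDerivAt_integral_logVariation_rpow {p : ℝ} (μ : Measure (sphere (0 : E) 1))
    [IsFiniteMeasure μ] (hc : Continuous H) (hp : ∀ v, 0 < H v) (hφ : Continuous φ) :
    HasDerivAt (fun t => ∫ v, logVariation H φ t v ^ p ∂μ) (p * ∫ v, H v ^ p * φ v ∂μ) 0 := by
  have hHp : Continuous fun v => H v ^ p := hc.rpow_const fun v => Or.inl (hp v).ne'
  have hpow : ∀ t v, logVariation H φ t v ^ p = H v ^ p * Real.exp (p * φ v * t) := by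
    intro t v
    rw [logVariation, Real.mul_rpow (hp v).le (Real.exp_pos _).le, ← Real.exp_mul]
    ring_nf
  have hb : Continuous fun v : sphere (0 : E) 1 => |H v ^ p| * (|p * φ v| * Real.exp (|p * φ v|)) := by
    fun_prop
  simp only [hpow]
  rw [← integral_const_mul]
  have key := (hasDerivAt_integral_of_dominated_loc_of_deriv_le (μ := μ) (x₀ := (0 : ℝ))
    (F := fun t v => H v ^ p * Real.exp (p * φ v * t))
    (F' := fun t v => H v ^ p * (Real.exp (p * φ v * t) * (p * φ v)))
    (bound := fun v => |H v ^ p| * (|p * φ v| * Real.exp (|p * φ v|)))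
    (ball_mem_nhds (0 : ℝ) one_pos)
    (Eventually.of_forall fun t => Continuous.aestronglyMeasurable (by fun_prop))
    (integrable_of_continuous (by fun_prop))
    (Continuous.aestronglyMeasurable (by fun_prop)) (Eventually.of_forall fun v t ht => ?_)
    (integrable_of_continuous hb) (Eventually.of_forall fun v t ht => ?_)).2
  · refine key.congr_deriv (integral_congr_ae (Eventually.of_forall fun v => ?_))
    simp
    ring
  · have h3 : |t| < 1 := by simpa using ht
    rw [Real.norm_eq_abs, abs_mul, abs_mul, Real.abs_exp, mul_comm (Real.exp _)]
    gcongr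
    calc p * φ v * t ≤ |p * φ v| * |t| := by rw [← abs_mul]; exact le_abs_self _
      _ ≤ |p * φ v| := mul_le_of_le_one_right (abs_nonneg _) h3.le
  · refine HasDerivAt.const_mul _ ?_
    have := ((hasDerivAt_id t).const_mul (p * φ v)).exp
    simpa using this

end Variation

/-! ### Support functions and symmetric bodies -/

section Support

variable {n : ℕ} {K L : Set (EuclideanSpace ℝ (Fin n))}

/-- The support function restricted to the unit sphere. -/
def sphereSupport (K : Set (EuclideanSpace ℝ (Fin n)))
    (v : sphere (0 : EuclideanSpace ℝ (Fin n)) 1) : ℝ :=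
  supportFn K v

/-- Nonempty compact convex sets that are symmetric about the origin. -/
structure IsSymmConvexCompact (K : Set (EuclideanSpace ℝ (Fin n))) : Prop where
  isCompact : IsCompact K
  convex : Convex ℝ K
  nonempty : K.Nonempty
  neg_mem : ∀ x ∈ K, -x ∈ K

theorem IsCompact.inner_le_supportFn (hK : IsCompact K) {y : EuclideanSpace ℝ (Fin n)}
    (hy : y ∈ K) (v : EuclideanSpace ℝ (Fin n)) : inner ℝ v y ≤ supportFn K v :=
  le_csSup (hK.bddAbove_image (by fun_prop)) ⟨y, hy, rfl⟩

theorem supportFn_le (hne : K.Nonempty) {v : EuclideanSpace ℝ (Fin n)} {a : ℝ}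
    (h : ∀ y ∈ K, inner ℝ v y ≤ a) : supportFn K v ≤ a :=
  csSup_le (hne.image _) (by rintro _ ⟨y, hy, rfl⟩; exact h y hy)

theorem IsCompact.continuous_supportFn (hK : IsCompact K) (hne : K.Nonempty) :
    Continuous (supportFn K) := by
  obtain ⟨R, hR⟩ := hK.exists_bound_of_continuousOn continuousOn_id
  have key : ∀ v w, supportFn K v - supportFn K w ≤ R * dist v w := by
    intro v w
    rw [sub_le_iff_le_add]
    refine supportFn_le hne fun y hy => ?_
    have h1 := hK.inner_le_supportFn hy w
    have h2 : inner ℝ (v - w) y ≤ ‖v - w‖ * ‖y‖ := real_inner_le_norm _ _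
    have h3 : ‖v - w‖ * ‖y‖ ≤ ‖v - w‖ * R := by gcongr; exact hR y hy
    rw [inner_sub_left] at h2
    rw [dist_eq_norm, mul_comm]
    linarith
  refine (LipschitzWith.of_dist_le_mul (K := R.toNNReal) fun v w => ?_).continuous
  rw [Real.dist_eq]
  have hR' : R * dist v w ≤ R.toNNReal * dist v w := by
    gcongr; exact Real.le_coe_toNNReal R
  refine (abs_sub_le_iff.2 ⟨key v w, ?_⟩).trans hR'
  rw [dist_comm]
  exact key w v

theorem IsCompact.continuous_sphereSupport (hK : IsCompact K) (hne : K.Nonempty) :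
    Continuous (sphereSupport K) :=
  (hK.continuous_supportFn hne).comp continuous_subtype_val

theorem sphereSupport_neg (hs : ∀ x ∈ K, -x ∈ K) (v : sphere (0 : EuclideanSpace ℝ (Fin n)) 1) :
    sphereSupport K (-v) = sphereSupport K v := by
  simp only [sphereSupport, supportFn]
  congr 1
  ext a
  constructor
  · rintro ⟨y, hy, rfl⟩; exact ⟨-y, hs y hy, by simp⟩
  · rintro ⟨y, hy, rfl⟩; exact ⟨-y, hs y hy, by simp⟩

/-- A point outside K is strictly separated from it by some w, nonzero because K is nonempty; the
normalised w violates the defining inequality of the Wulff shape. -/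
theorem eq_wulffShape_sphereSupport (hK : IsCompact K) (hconv : Convex ℝ K) (hne : K.Nonempty) :
    K = wulffShape (sphereSupport K) := by
  apply Subset.antisymm
  · intro x hx v
    rw [real_inner_comm]
    exact hK.inner_le_supportFn hx _
  · intro x hx
    by_contra hxK
    obtain ⟨f, u, hu, hxu⟩ := geometric_hahn_banach_closed_point hconv hK.isClosed hxK
    set w := (InnerProductSpace.toDual ℝ (EuclideanSpace ℝ (Fin n))).symm f with hw
    have hf : ∀ y, f y = inner ℝ w y := fun y => by
      rw [hw, InnerProductSpace.toDual_symm_apply]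
    have hw0 : w ≠ 0 := by
      intro h0
      obtain ⟨y, hy⟩ := hne
      have h1 := hu y hy
      rw [hf, h0, inner_zero_left] at h1
      rw [hf, h0, inner_zero_left] at hxu
      linarith
    have hwn : 0 < ‖w‖ := norm_pos_iff.2 hw0
    have h1 := hx ⟨‖w‖⁻¹ • w, by simp [norm_smul, hw0]⟩
    simp only [sphereSupport] at h1
    have h2 : supportFn K (‖w‖⁻¹ • w) ≤ ‖w‖⁻¹ * u := supportFn_le hne fun y hy => by
      rw [real_inner_smul_left]
      gcongr
      rw [← hf]
      exact (hu y hy).le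
    rw [real_inner_smul_right, real_inner_comm, ← hf] at h1
    have h3 := le_of_mul_le_mul_left (h1.trans h2) (by positivity)
    linarith

/-- Equality may fail, but this direction suffices: passing to the Wulff shape can only lower the
functional being minimised. -/
theorem sphereSupport_wulffShape_le {H : sphere (0 : EuclideanSpace ℝ (Fin n)) 1 → ℝ}
    (hp : ∀ v, 0 < H v) (v : sphere (0 : EuclideanSpace ℝ (Fin n)) 1) :
    sphereSupport (wulffShape H) v ≤ H v := by
  refine supportFn_le ⟨0, fun w => ?_⟩ fun y hy => ?_
  · rw [inner_zero_left]; exact (hp w).le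
  · rw [real_inner_comm]; exact hy v

theorem zero_mem_interior_wulffShape {H : sphere (0 : EuclideanSpace ℝ (Fin n)) 1 → ℝ}
    (hc : Continuous H) (hp : ∀ v, 0 < H v) : 0 ∈ interior (wulffShape H) := by
  obtain ⟨a, ha, hb⟩ := exists_lower_bound hc hp
  rw [mem_interior_iff_mem_nhds]
  refine mem_of_superset (ball_mem_nhds _ ha) fun x hx v => ?_
  have h1 : inner ℝ x (v : EuclideanSpace ℝ (Fin n)) ≤ ‖x‖ := by
    simpa using real_inner_le_norm x (v : EuclideanSpace ℝ (Fin n))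
  have h2 : ‖x‖ < a := by simpa using hx
  linarith [hb v]

theorem isCompact_wulffShape [Nontrivial (EuclideanSpace ℝ (Fin n))]
    {H : sphere (0 : EuclideanSpace ℝ (Fin n)) 1 → ℝ}
    (hc : Continuous H) (hp : ∀ v, 0 < H v) : IsCompact (wulffShape H) := by
  obtain ⟨b, hb0, hb⟩ := exists_upper_bound hc
  refine (isCompact_closedBall 0 b).of_isClosed_subset wulffShape_isClosed fun x hx => ?_
  rw [mem_closedBall_zero_iff]
  refine (norm_le_mul_wulffGauge hc hp hb x).trans ?_
  exact mul_le_of_le_one_right hb0.le ((mem_wulffShape_iff hc hp).1 hx)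

theorem isSymmConvexCompact_wulffShape [Nontrivial (EuclideanSpace ℝ (Fin n))]
    {H : sphere (0 : EuclideanSpace ℝ (Fin n)) 1 → ℝ}
    (hc : Continuous H) (hp : ∀ v, 0 < H v) (he : ∀ v, H (-v) = H v) :
    IsSymmConvexCompact (wulffShape H) :=
  ⟨isCompact_wulffShape hc hp, wulffShape_convex,
    ⟨0, interior_subset (zero_mem_interior_wulffShape hc hp)⟩, fun _ => neg_mem_wulffShape he⟩

namespace IsSymmConvexCompact

theorem zero_mem (hK : IsSymmConvexCompact K) : 0 ∈ K := by
  obtain ⟨x, hx⟩ := hK.nonempty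
  have := hK.convex hx (hK.neg_mem x hx) (a := 1 / 2) (b := 1 / 2) (by norm_num) (by norm_num)
    (by norm_num)
  simpa using this

theorem abs_inner_le_sphereSupport (hK : IsSymmConvexCompact K)
    {y : EuclideanSpace ℝ (Fin n)} (hy : y ∈ K)
    (v : sphere (0 : EuclideanSpace ℝ (Fin n)) 1) :
    |inner ℝ y (v : EuclideanSpace ℝ (Fin n))| ≤ sphereSupport K v := by
  rw [real_inner_comm, abs_le']
  refine ⟨hK.isCompact.inner_le_supportFn hy _, ?_⟩
  rw [← inner_neg_right]
  exact hK.isCompact.inner_le_supportFn (hK.neg_mem y hy) _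

theorem sphereSupport_nonneg (hK : IsSymmConvexCompact K)
    (v : sphere (0 : EuclideanSpace ℝ (Fin n)) 1) : 0 ≤ sphereSupport K v :=
  (abs_nonneg _).trans (hK.abs_inner_le_sphereSupport hK.zero_mem v)

/-- If the support function vanished at v, symmetry would put K inside the hyperplane orthogonal to
v, a null set. -/
theorem sphereSupport_pos_of_measure_ne_zero (hK : IsSymmConvexCompact K) {q : ℝ}
    (h : gaussDualMeasure (EuclideanSpace ℝ (Fin n)) q K ≠ 0)
    (v : sphere (0 : EuclideanSpace ℝ (Fin n)) 1) : 0 < sphereSupport K v := by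
  refine (hK.sphereSupport_nonneg v).lt_of_ne fun h0 => h ?_
  refine withDensity_absolutelyContinuous _ _ (measure_mono_null
    (t := ((ℝ ∙ (v : EuclideanSpace ℝ (Fin n)))ᗮ : Submodule ℝ _)) ?_
    (Measure.addHaar_submodule volume _ ?_))
  · intro y hy
    have := hK.abs_inner_le_sphereSupport hy v
    rw [← h0, abs_nonpos_iff] at this
    rw [SetLike.mem_coe, Submodule.mem_orthogonal_singleton_iff_inner_left]
    exact this
  · intro htop
    have : (v : EuclideanSpace ℝ (Fin n)) ∈ (ℝ ∙ (v : EuclideanSpace ℝ (Fin n)))ᗮ := by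
      rw [htop]; trivial
    rw [Submodule.mem_orthogonal_singleton_iff_inner_left, inner_self_eq_zero] at this
    exact sphere_coe_ne_zero v this

end IsSymmConvexCompact

end Support

/-! ### Existence of a minimiser -/

section Existence

open TopologicalSpace (NonemptyCompacts)

variable {n : ℕ}

/-- A compact set is convex exactly when its distance function is, and that function depends
continuously on the set in the Hausdorff metric. Symmetry is handled in the same way below. -/
theorem NonemptyCompacts.isClosed_setOf_convex :
    IsClosed {K : NonemptyCompacts (EuclideanSpace ℝ (Fin n)) |
      Convex ℝ (K : Set (EuclideanSpace ℝ (Fin n)))} := by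
  have : {K : NonemptyCompacts (EuclideanSpace ℝ (Fin n)) |
      Convex ℝ (K : Set (EuclideanSpace ℝ (Fin n)))} =
      ⋂ (x : EuclideanSpace ℝ (Fin n)) (y : EuclideanSpace ℝ (Fin n)) (a : ℝ) (b : ℝ) (_ : 0 ≤ a)
        (_ : 0 ≤ b) (_ : a + b = 1), {K : NonemptyCompacts (EuclideanSpace ℝ (Fin n)) |
          infDist (a • x + b • y) (K : Set (EuclideanSpace ℝ (Fin n))) ≤
            a * infDist x (K : Set (EuclideanSpace ℝ (Fin n))) +
            b * infDist y (K : Set (EuclideanSpace ℝ (Fin n)))} := by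
    ext K
    simp only [mem_iInter, mem_ofPred_eq]
    constructor
    · intro hK x y a b ha hb hab
      obtain ⟨x', hx', hxd⟩ := K.isCompact.exists_infDist_eq_dist K.nonempty x
      obtain ⟨y', hy', hyd⟩ := K.isCompact.exists_infDist_eq_dist K.nonempty y
      rw [hxd, hyd]
      refine (infDist_le_dist_of_mem (hK hx' hy' ha hb hab)).trans ?_
      refine (dist_add_add_le _ _ _ _).trans ?_
      rw [dist_smul₀, dist_smul₀, Real.norm_of_nonneg ha, Real.norm_of_nonneg hb]
    · intro h x hx y hy a b ha hb hab
      have h1 := h x y a b ha hb hab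
      rw [infDist_zero_of_mem hx, infDist_zero_of_mem hy, mul_zero, mul_zero, add_zero] at h1
      exact (K.isCompact.isClosed.mem_iff_infDist_zero K.nonempty).2
        (le_antisymm h1 infDist_nonneg)
  rw [this]
  refine isClosed_iInter fun x => isClosed_iInter fun y => isClosed_iInter fun a =>
    isClosed_iInter fun b => isClosed_iInter fun _ => isClosed_iInter fun _ =>
    isClosed_iInter fun _ => isClosed_le (lipschitz_infDist_set _).continuous ?_
  exact ((lipschitz_infDist_set _).continuous.const_mul _).add
    ((lipschitz_infDist_set _).continuous.const_mul _)

theorem NonemptyCompacts.isClosed_setOf_neg_mem :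
    IsClosed {K : NonemptyCompacts (EuclideanSpace ℝ (Fin n)) |
      ∀ x ∈ (K : Set (EuclideanSpace ℝ (Fin n))), -x ∈ (K : Set (EuclideanSpace ℝ (Fin n)))} := by
  have : {K : NonemptyCompacts (EuclideanSpace ℝ (Fin n)) |
      ∀ x ∈ (K : Set (EuclideanSpace ℝ (Fin n))), -x ∈ (K : Set (EuclideanSpace ℝ (Fin n)))} =
      ⋂ (x : EuclideanSpace ℝ (Fin n)), {K : NonemptyCompacts (EuclideanSpace ℝ (Fin n)) |
          infDist (-x) (K : Set (EuclideanSpace ℝ (Fin n))) ≤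
            infDist x (K : Set (EuclideanSpace ℝ (Fin n)))} := by
    ext K
    simp only [mem_iInter, mem_ofPred_eq]
    constructor
    · intro hK x
      obtain ⟨x', hx', hxd⟩ := K.isCompact.exists_infDist_eq_dist K.nonempty x
      rw [hxd, ← dist_neg_neg]
      exact infDist_le_dist_of_mem (hK x' hx')
    · intro h x hx
      have h1 := h x
      rw [infDist_zero_of_mem hx] at h1
      exact (K.isCompact.isClosed.mem_iff_infDist_zero K.nonempty).2
        (le_antisymm h1 infDist_nonneg)
  rw [this]
  exact isClosed_iInter fun x => isClosed_le (lipschitz_infDist_set _).continuous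
    (lipschitz_infDist_set _).continuous

/-- Upper semicontinuity: K_j lies in the closed thickening of its limit L of radius dist(K_j, L),
and the measures of these thickenings tend to that of L. -/
theorem NonemptyCompacts.isClosed_setOf_le_measure {X : Type*} [MetricSpace X] [ProperSpace X]
    [MeasurableSpace X] [OpensMeasurableSpace X] (m : Measure X) [IsFiniteMeasureOnCompacts m]
    (c : ℝ≥0∞) : IsClosed {K : NonemptyCompacts X | c ≤ m (K : Set X)} := by
  refine IsSeqClosed.isClosed fun K L hK hKL => ?_
  have h1 : Tendsto (fun j => dist (K j) L) atTop (𝓝 0) := tendsto_iff_dist_tendsto_zero.1 hKL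
  have h2 := (tendsto_measure_cthickening_of_isCompact (μ := m) L.isCompact).comp h1
  refine ge_of_tendsto h2 (Eventually.of_forall fun j => (hK j).trans (measure_mono ?_))
  intro x hx
  obtain ⟨z, hz, hxz⟩ := L.isCompact.exists_infDist_eq_dist L.nonempty x
  refine mem_cthickening_of_dist_le x z _ _ hz ?_
  rw [← hxz]
  exact infDist_le_hausdorffDist_of_mem hx (edist_ne_top (K j) L)

theorem dist_sphereSupport_le (K L : NonemptyCompacts (EuclideanSpace ℝ (Fin n)))
    (v : sphere (0 : EuclideanSpace ℝ (Fin n)) 1) :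
    dist (sphereSupport (K : Set (EuclideanSpace ℝ (Fin n))) v)
      (sphereSupport (L : Set (EuclideanSpace ℝ (Fin n))) v) ≤ dist K L := by
  have key : ∀ K L : NonemptyCompacts (EuclideanSpace ℝ (Fin n)),
      sphereSupport (K : Set (EuclideanSpace ℝ (Fin n))) v -
        sphereSupport (L : Set (EuclideanSpace ℝ (Fin n))) v ≤ dist K L := by
    intro K L
    rw [sub_le_iff_le_add]
    refine supportFn_le K.nonempty fun y hy => ?_
    obtain ⟨z, hz, hyz⟩ := L.isCompact.exists_infDist_eq_dist L.nonempty y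
    have h1 : dist y z ≤ dist K L := by
      rw [← hyz]
      exact infDist_le_hausdorffDist_of_mem hy (edist_ne_top K L)
    have h2 := L.isCompact.inner_le_supportFn hz (v : EuclideanSpace ℝ (Fin n))
    have h3 := real_inner_le_norm (v : EuclideanSpace ℝ (Fin n)) (y - z)
    rw [norm_sphere_coe, one_mul, ← dist_eq_norm, inner_sub_right] at h3
    unfold sphereSupport
    linarith
  rw [Real.dist_eq]
  refine abs_sub_le_iff.2 ⟨key K L, ?_⟩
  rw [dist_comm]
  exact key L K

theorem isFiniteMeasureOnCompacts_gaussDualMeasure [Nontrivial (EuclideanSpace ℝ (Fin n))] {q : ℝ}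
    (hq : 0 < q) :
    IsFiniteMeasureOnCompacts (gaussDualMeasure (EuclideanSpace ℝ (Fin n)) q) := by
  refine ⟨fun C hC => ?_⟩
  obtain ⟨R, hR⟩ := hC.exists_bound_of_continuousOn continuousOn_id
  -- The maximum with 1 keeps the constant positive, as the polar formula requires.
  have h : C ⊆ wulffShape fun _ => max R 1 := by
    intro x hx v
    have h1 := real_inner_le_norm x (v : EuclideanSpace ℝ (Fin n))
    rw [norm_sphere_coe, mul_one] at h1
    exact h1.trans ((hR x hx).trans (le_max_left _ _))
  refine (measure_mono h).trans_lt ?_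
  rw [gaussDualMeasure_wulffShape hq continuous_const fun _ => by positivity]
  exact ENNReal.ofReal_lt_top

/-- Coercivity. The integral is continuous on the unit sphere and homogeneous of degree p; a zero
minimum at e₀ would concentrate μ on the great subsphere orthogonal to e₀. -/
theorem exists_pos_le_integral_abs_inner_rpow [Nontrivial (EuclideanSpace ℝ (Fin n))] {p : ℝ}
    (hp : 0 < p) (μ : Measure (sphere (0 : EuclideanSpace ℝ (Fin n)) 1)) [IsFiniteMeasure μ]
    (hμ : μ ≠ 0) (hnull : ∀ e : EuclideanSpace ℝ (Fin n), e ≠ 0 →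
      μ {v : sphere (0 : EuclideanSpace ℝ (Fin n)) 1 |
        inner ℝ e (v : EuclideanSpace ℝ (Fin n)) = 0} = 0) :
    ∃ a : ℝ, 0 < a ∧ ∀ e : EuclideanSpace ℝ (Fin n), a * ‖e‖ ^ p ≤
      ∫ v, |inner ℝ e (v : EuclideanSpace ℝ (Fin n))| ^ p ∂μ := by
  set Φ : EuclideanSpace ℝ (Fin n) → ℝ := fun e =>
    ∫ v, |inner ℝ e (v : EuclideanSpace ℝ (Fin n))| ^ p ∂μ with hΦ
  have hcv : ∀ e : EuclideanSpace ℝ (Fin n), Continuous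
      fun v : sphere (0 : EuclideanSpace ℝ (Fin n)) 1 =>
        |inner ℝ e (v : EuclideanSpace ℝ (Fin n))| ^ p := fun e =>
    Continuous.rpow_const (by fun_prop) fun _ => Or.inr hp.le
  have hcont : ContinuousOn Φ (sphere 0 1) := by
    refine continuousOn_of_dominated (bound := fun _ => 1)
      (fun e _ => (hcv e).aestronglyMeasurable) (fun e he => Eventually.of_forall fun v => ?_)
      (integrable_const _) (Eventually.of_forall fun v => Continuous.continuousOn ?_)
    · have h1 := abs_real_inner_le_norm e (v : EuclideanSpace ℝ (Fin n))
      rw [norm_sphere_coe, mem_sphere_zero_iff_norm.1 he, one_mul] at h1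
      rw [Real.norm_of_nonneg (by positivity)]
      exact Real.rpow_le_one (abs_nonneg _) h1 hp.le
    · exact Continuous.rpow_const (by fun_prop) fun _ => Or.inr hp.le
  obtain ⟨e₀, he₀, hmin⟩ := (isCompact_sphere (0 : EuclideanSpace ℝ (Fin n)) 1).exists_isMinOn
    (NormedSpace.sphere_nonempty.2 zero_le_one) hcont
  have he₀0 : e₀ ≠ 0 := by
    rintro rfl; simp at he₀
  have hpos : 0 < Φ e₀ := by
    have hn : 0 ≤ Φ e₀ := integral_nonneg fun v => by positivity
    refine hn.lt_of_ne fun h0 => hμ ?_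
    have h1 := (integral_eq_zero_iff_of_nonneg (fun v => by positivity)
      (integrable_of_continuous (hcv e₀))).1 h0.symm
    have h2 : ∀ᵐ v : sphere (0 : EuclideanSpace ℝ (Fin n)) 1 ∂μ,
        inner ℝ e₀ (v : EuclideanSpace ℝ (Fin n)) ≠ 0 := by
      refine ae_iff.2 ?_
      simp only [ne_eq, not_not]
      exact hnull e₀ he₀0
    have h3 : ∀ᵐ v ∂μ, False := by
      filter_upwards [h1, h2] with v hv1 hv2
      have : 0 < |inner ℝ e₀ (v : EuclideanSpace ℝ (Fin n))| ^ p :=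
        Real.rpow_pos_of_pos (abs_pos.2 hv2) p
      exact this.ne' hv1
    simpa using h3
  refine ⟨Φ e₀, hpos, fun e => ?_⟩
  rcases eq_or_ne e 0 with rfl | he
  · rw [norm_zero, Real.zero_rpow hp.ne', mul_zero]
    exact integral_nonneg fun v => by positivity
  · have hen : 0 < ‖e‖ := norm_pos_iff.2 he
    have h1 : Φ e₀ ≤ Φ (‖e‖⁻¹ • e) := hmin (by simp [norm_smul, he])
    have h2 : Φ e = ‖e‖ ^ p * Φ (‖e‖⁻¹ • e) := by
      simp only [hΦ]
      rw [← integral_const_mul]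
      refine integral_congr_ae (Eventually.of_forall fun v => ?_)
      simp only
      rw [← Real.mul_rpow (by positivity) (by positivity), real_inner_smul_left, abs_mul,
        abs_of_pos (inv_pos.2 hen)]
      congr 1
      field_simp
    change Φ e₀ * ‖e‖ ^ p ≤ Φ e
    rw [h2, mul_comm]
    gcongr

/-- Existence of a minimizer of the `L_p` functional among symmetric convex bodies with Gaussian
dual quermassintegral bounded below. -/
theorem exists_minimizer [Nontrivial (EuclideanSpace ℝ (Fin n))] {p q : ℝ} (hp : 0 < p)
    (hq : 0 < q) (μ : Measure (sphere (0 : EuclideanSpace ℝ (Fin n)) 1)) [IsFiniteMeasure μ]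
    (hμ : μ ≠ 0) (hnull : ∀ e : EuclideanSpace ℝ (Fin n), e ≠ 0 →
      μ {v : sphere (0 : EuclideanSpace ℝ (Fin n)) 1 |
        inner ℝ e (v : EuclideanSpace ℝ (Fin n)) = 0} = 0) :
    ∃ K : Set (EuclideanSpace ℝ (Fin n)), IsSymmConvexCompact K ∧
      gaussDualMeasure (EuclideanSpace ℝ (Fin n)) q K ≠ 0 ∧
      ∀ L : Set (EuclideanSpace ℝ (Fin n)), IsSymmConvexCompact L →
        gaussDualMeasure (EuclideanSpace ℝ (Fin n)) q K ≤
          gaussDualMeasure (EuclideanSpace ℝ (Fin n)) q L →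
        ∫ v, sphereSupport K v ^ p ∂μ ≤ ∫ v, sphereSupport L v ^ p ∂μ := by
  set m := gaussDualMeasure (EuclideanSpace ℝ (Fin n)) q with hm
  have := isFiniteMeasureOnCompacts_gaussDualMeasure (n := n) hq
  set B : Set (EuclideanSpace ℝ (Fin n)) := wulffShape fun _ => 1 with hB
  have hBs : IsSymmConvexCompact B :=
    isSymmConvexCompact_wulffShape continuous_const (fun _ => one_pos) fun _ => rfl
  have hmB : m B ≠ 0 := by
    have h1 : 0 < ∫ u : sphere (0 : EuclideanSpace ℝ (Fin n)) 1, radialPrimitive q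
        (wulffGauge (fun _ => 1) (u : EuclideanSpace ℝ (Fin n)))⁻¹
          ∂(volume : Measure (EuclideanSpace ℝ (Fin n))).toSphere := by
      have hpos : ∀ u : sphere (0 : EuclideanSpace ℝ (Fin n)) 1, 0 < radialPrimitive q
        (wulffGauge (fun _ => 1) (u : EuclideanSpace ℝ (Fin n)))⁻¹ := fun u =>
        radialPrimitive_pos hq (inv_pos.2 (wulffGauge_sphere_pos continuous_const
          (fun _ => one_pos) u))
      rw [integral_pos_iff_support_of_nonneg (fun u => (hpos u).le) (integrable_of_continuous
        ((continuous_radialPrimitive hq).comp (continuous_inv_wulffGauge_sphere continuous_const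
          (fun _ => one_pos))))]
      rw [show Function.support _ = univ from eq_univ_of_forall fun u => (hpos u).ne']
      exact Measure.measure_univ_pos.2 (Measure.toSphere_ne_zero _)
    rw [hm, hB, gaussDualMeasure_wulffShape hq continuous_const fun _ => one_pos]
    exact (ENNReal.ofReal_pos.2 h1).ne'
  obtain ⟨a, ha, hcoer⟩ := exists_pos_le_integral_abs_inner_rpow hp μ hμ hnull
  set J : Set (EuclideanSpace ℝ (Fin n)) → ℝ := fun K => ∫ v, sphereSupport K v ^ p ∂μ with hJ
  have hJint : ∀ K : Set (EuclideanSpace ℝ (Fin n)), IsSymmConvexCompact K →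
      Continuous fun v => sphereSupport K v ^ p := fun K hK =>
    (hK.isCompact.continuous_sphereSupport hK.nonempty).rpow_const fun _ => Or.inr hp.le
  -- For y in K, |⟨y,v⟩| ≤ h_K(v), hence a|y|^p ≤ J(K) ≤ J(B).
  have hbound : ∀ K : Set (EuclideanSpace ℝ (Fin n)), IsSymmConvexCompact K → J K ≤ J B →
      K ⊆ closedBall 0 ((J B / a) ^ p⁻¹) := by
    intro K hK hKB y hy
    rw [mem_closedBall_zero_iff]
    have h1 : a * ‖y‖ ^ p ≤ J K := (hcoer y).trans <|
      integral_mono (integrable_of_continuous (Continuous.rpow_const (by fun_prop)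
        fun _ => Or.inr hp.le)) (integrable_of_continuous (hJint K hK)) fun v =>
        Real.rpow_le_rpow (abs_nonneg _) (hK.abs_inner_le_sphereSupport hy v) hp.le
    have h2 : ‖y‖ ^ p ≤ J B / a := by
      rw [le_div_iff₀ ha, mul_comm]; exact h1.trans hKB
    calc ‖y‖ = (‖y‖ ^ p) ^ p⁻¹ := by rw [Real.rpow_rpow_inv (norm_nonneg _) hp.ne']
      _ ≤ _ := by gcongr
  set R := (J B / a) ^ p⁻¹ with hR
  set 𝒜 : Set (NonemptyCompacts (EuclideanSpace ℝ (Fin n))) :=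
    {K | (K : Set (EuclideanSpace ℝ (Fin n))) ⊆ closedBall 0 R} ∩
      ({K | Convex ℝ (K : Set (EuclideanSpace ℝ (Fin n)))} ∩
        ({K | ∀ x ∈ (K : Set (EuclideanSpace ℝ (Fin n))),
          -x ∈ (K : Set (EuclideanSpace ℝ (Fin n)))} ∩
        {K | m B ≤ m (K : Set (EuclideanSpace ℝ (Fin n)))})) with h𝒜
  have hsym : ∀ K ∈ 𝒜, IsSymmConvexCompact (K : Set (EuclideanSpace ℝ (Fin n))) := fun K hK =>
    ⟨K.isCompact, hK.2.1, K.nonempty, hK.2.2.1⟩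
  have hmem : ∀ (K : Set (EuclideanSpace ℝ (Fin n))) (hK : IsSymmConvexCompact K),
      J K ≤ J B → m B ≤ m K → (⟨⟨K, hK.isCompact⟩, hK.nonempty⟩ :
        NonemptyCompacts (EuclideanSpace ℝ (Fin n))) ∈ 𝒜 := fun K hK h1 h2 =>
    ⟨hbound K hK h1, hK.convex, hK.neg_mem, h2⟩
  -- Blaschke selection: compact subsets of a fixed ball form a compact space, and the other three
  -- conditions are closed.
  have hcomp : IsCompact 𝒜 :=
    (NonemptyCompacts.isCompact_subsets_of_isCompact (isCompact_closedBall 0 R)).inter_right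
      (NonemptyCompacts.isClosed_setOf_convex.inter
        (NonemptyCompacts.isClosed_setOf_neg_mem.inter
          (NonemptyCompacts.isClosed_setOf_le_measure m _)))
  have hJc : ContinuousOn (fun K : NonemptyCompacts (EuclideanSpace ℝ (Fin n)) =>
      J (K : Set (EuclideanSpace ℝ (Fin n)))) 𝒜 := by
    refine continuousOn_of_dominated (bound := fun _ => R ^ p)
      (fun K hK => (hJint _ (hsym K hK)).aestronglyMeasurable)
      (fun K hK => Eventually.of_forall fun v => ?_) (integrable_const _)
      (Eventually.of_forall fun v => Continuous.continuousOn ?_)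
    · have h0 := (hsym K hK).sphereSupport_nonneg v
      rw [Real.norm_of_nonneg (by positivity)]
      refine Real.rpow_le_rpow h0 (supportFn_le K.nonempty fun y hy => ?_) hp.le
      have h1 := real_inner_le_norm (v : EuclideanSpace ℝ (Fin n)) y
      rw [norm_sphere_coe, one_mul] at h1
      exact h1.trans (mem_closedBall_zero_iff.1 (hK.1 hy))
    · refine Continuous.rpow_const ?_ fun _ => Or.inr hp.le
      exact (LipschitzWith.of_dist_le_mul (K := 1) fun K L => by
        simpa using dist_sphereSupport_le K L v).continuous
  obtain ⟨K, hK, hKmin⟩ := hcomp.exists_isMinOn ⟨_, hmem B hBs le_rfl le_rfl⟩ hJc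
  refine ⟨K, hsym K hK, fun h0 => hmB (le_antisymm (hK.2.2.2.trans h0.le) zero_le),
    fun L hL hmL => ?_⟩
  -- A competitor with J(L) > J(B) may leave the ball defining 𝒜, but it already loses to B.
  by_cases hJL : J L ≤ J B
  · exact hKmin (hmem L hL hJL (le_trans hK.2.2.2 hmL))
  · have h1 : J (K : Set (EuclideanSpace ℝ (Fin n))) ≤ J B := hKmin (hmem B hBs le_rfl le_rfl)
    exact h1.trans (not_le.1 hJL).le

end Existence

/-! ### The Euler-Lagrange equation -/

section EulerLagrange

theorem HasDerivAt.nonneg_of_eventually_ge {f : ℝ → ℝ} {f' : ℝ} (hf : HasDerivAt f f' 0)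
    (h : ∀ᶠ t in 𝓝[>] 0, f 0 ≤ f t) : 0 ≤ f' := by
  have h0 : 𝓝[>] (0 : ℝ) ≤ 𝓝[≠] 0 := nhdsWithin_mono 0 fun t (ht : 0 < t) => ht.ne'
  have h1 := (hasDerivAt_iff_tendsto_slope.1 hf).mono_left h0
  refine ge_of_tendsto h1 ?_
  filter_upwards [h, self_mem_nhdsWithin] with t ht ht0
  have ht0' : (0 : ℝ) < t := ht0
  rw [slope_def_field, sub_zero]
  exact div_nonneg (sub_nonneg.2 ht) ht0'.le

theorem HasDerivAt.eventually_lt_of_pos {f : ℝ → ℝ} {f' : ℝ} (hf : HasDerivAt f f' 0)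
    (h : 0 < f') : ∀ᶠ t in 𝓝[>] 0, f 0 < f t := by
  have h0 : 𝓝[>] (0 : ℝ) ≤ 𝓝[≠] 0 := nhdsWithin_mono 0 fun t (ht : 0 < t) => ht.ne'
  have h1 := (hasDerivAt_iff_tendsto_slope.1 hf).mono_left h0
  filter_upwards [h1.eventually (eventually_gt_nhds h), self_mem_nhdsWithin] with t ht ht0
  have ht0' : (0 : ℝ) < t := ht0
  rw [slope_def_field, sub_zero, div_pos_iff_of_pos_right ht0'] at ht
  linarith

variable {E : Type*} [NormedAddCommGroup E] [InnerProductSpace ℝ E] [FiniteDimensional ℝ E]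

/-- The density, in polar coordinates, of the zeroth Gaussian dual curvature measure. -/
def radialWeight (q : ℝ) (H : sphere (0 : E) 1 → ℝ) (u : sphere (0 : E) 1) : ℝ :=
  (wulffGauge H (u : E))⁻¹ ^ q * Real.exp (-((wulffGauge H (u : E))⁻¹ ^ 2) / 2)

theorem radialWeight_neg {q : ℝ} {H : sphere (0 : E) 1 → ℝ} (he : ∀ v, H (-v) = H v)
    (u : sphere (0 : E) 1) : radialWeight q H (-u) = radialWeight q H u := by
  simp [radialWeight, wulffGauge_neg he]

variable [MeasurableSpace E] [BorelSpace E]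

theorem radialWeight_pos {q : ℝ} {H : sphere (0 : E) 1 → ℝ} (hc : Continuous H)
    (hp : ∀ v, 0 < H v) (u : sphere (0 : E) 1) : 0 < radialWeight q H u := by
  have := wulffGauge_sphere_pos hc hp u
  unfold radialWeight
  positivity

open scoped Pointwise in
theorem measurePreserving_neg_toSphere :
    MeasurePreserving (fun v : sphere (0 : E) 1 => -v) (volume : Measure E).toSphere
      (volume : Measure E).toSphere := by
  refine ⟨measurable_neg, Measure.ext fun s hs => ?_⟩
  rw [Measure.map_apply measurable_neg hs, Measure.toSphere_apply' _ (measurable_neg hs),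
    Measure.toSphere_apply' _ hs]
  congr 1
  rw [← Measure.measure_neg (volume : Measure E) (Ioo (0 : ℝ) 1 • ((↑) '' s : Set E))]
  congr 1
  ext x
  constructor
  · rintro ⟨r, hr, _, ⟨u, hu, rfl⟩, rfl⟩
    exact ⟨r, hr, _, ⟨-u, hu, rfl⟩, by simp⟩
  · rintro ⟨r, hr, _, ⟨u, hu, rfl⟩, hx⟩
    refine ⟨r, hr, _, ⟨-u, by simpa using hu, rfl⟩, ?_⟩
    rw [← neg_neg x, ← hx]
    simp

variable {n : ℕ} {K : Set (EuclideanSpace ℝ (Fin n))}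

/-- A direction that increases the constrained measure to first order stays admissible for small t >
0. Minimality and the comparison of the Wulff shape with h exp(tφ) then make the derivative of the
upper bound nonnegative. -/
theorem integral_nonneg_of_minimizer [Nontrivial (EuclideanSpace ℝ (Fin n))] {p q : ℝ} (hp : 0 < p)
    (hq : 0 < q) (μ : Measure (sphere (0 : EuclideanSpace ℝ (Fin n)) 1)) [IsFiniteMeasure μ]
    (hK : IsSymmConvexCompact K) (hm : gaussDualMeasure (EuclideanSpace ℝ (Fin n)) q K ≠ 0)
    (hmin : ∀ L : Set (EuclideanSpace ℝ (Fin n)), IsSymmConvexCompact L →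
        gaussDualMeasure (EuclideanSpace ℝ (Fin n)) q K ≤
          gaussDualMeasure (EuclideanSpace ℝ (Fin n)) q L →
        ∫ v, sphereSupport K v ^ p ∂μ ≤ ∫ v, sphereSupport L v ^ p ∂μ)
    {φ : sphere (0 : EuclideanSpace ℝ (Fin n)) 1 → ℝ} (hφ : Continuous φ)
    (hφe : ∀ v, φ (-v) = φ v)
    (hD : 0 < ∫ u, radialWeight q (sphereSupport K) u *
      φ (wulffNormal (sphereSupport K) (u : EuclideanSpace ℝ (Fin n)))
        ∂(volume : Measure (EuclideanSpace ℝ (Fin n))).toSphere) :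
    0 ≤ ∫ v, sphereSupport K v ^ p * φ v ∂μ := by
  set h := sphereSupport K with hh
  have hc : Continuous h := hK.isCompact.continuous_sphereSupport hK.nonempty
  have hpos : ∀ v, 0 < h v := hK.sphereSupport_pos_of_measure_ne_zero hm
  have he : ∀ v, h (-v) = h v := sphereSupport_neg hK.neg_mem
  have hKw : K = wulffShape h := eq_wulffShape_sphereSupport hK.isCompact hK.convex hK.nonempty
  have h1 := (hasDerivAt_integral_radialPrimitive hq hc hpos hφ).eventually_lt_of_pos hD
  have h2 : 0 ≤ p * ∫ v, h v ^ p * φ v ∂μ := by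
    refine (hasDerivAt_integral_logVariation_rpow (p := p) μ hc hpos hφ).nonneg_of_eventually_ge ?_
    filter_upwards [h1] with t ht
    have htc := continuous_logVariation hc hφ t
    have htp := logVariation_pos (φ := φ) hpos t
    have hts : IsSymmConvexCompact (wulffShape (logVariation h φ t)) :=
      isSymmConvexCompact_wulffShape htc htp fun v => by simp [logVariation, he, hφe]
    have h3 : gaussDualMeasure (EuclideanSpace ℝ (Fin n)) q K ≤
        gaussDualMeasure (EuclideanSpace ℝ (Fin n)) q (wulffShape (logVariation h φ t)) := by
      rw [hKw, gaussDualMeasure_wulffShape hq hc hpos, gaussDualMeasure_wulffShape hq htc htp]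
      rw [logVariation_zero] at ht
      exact ENNReal.ofReal_le_ofReal ht.le
    rw [logVariation_zero]
    refine (hmin _ hts h3).trans (integral_mono (integrable_of_continuous ?_)
      (integrable_of_continuous ?_) fun v => ?_)
    · exact (hts.isCompact.continuous_sphereSupport hts.nonempty).rpow_const fun _ => Or.inr hp.le
    · exact htc.rpow_const fun _ => Or.inr hp.le
    · exact Real.rpow_le_rpow (hts.sphereSupport_nonneg v) (sphereSupport_wulffShape_le htp v) hp.le
  exact nonneg_of_mul_nonneg_right h2 hp

/-- With D and M the two first variations, viewed as linear functionals and up to the factor p, D φ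
> 0 implies M φ ≥ 0 on even φ; so M is a multiple of D there, by the ratio of their positive values
at 1. -/
theorem exists_multiplier_of_minimizer [Nontrivial (EuclideanSpace ℝ (Fin n))] {p q : ℝ}
    (hp : 0 < p) (hq : 0 < q) (μ : Measure (sphere (0 : EuclideanSpace ℝ (Fin n)) 1))
    [IsFiniteMeasure μ] (hμ : μ ≠ 0)
    (hμneg : MeasurePreserving (fun v : sphere (0 : EuclideanSpace ℝ (Fin n)) 1 => -v) μ μ)
    (hK : IsSymmConvexCompact K) (hm : gaussDualMeasure (EuclideanSpace ℝ (Fin n)) q K ≠ 0)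
    (hmin : ∀ L : Set (EuclideanSpace ℝ (Fin n)), IsSymmConvexCompact L →
        gaussDualMeasure (EuclideanSpace ℝ (Fin n)) q K ≤
          gaussDualMeasure (EuclideanSpace ℝ (Fin n)) q L →
        ∫ v, sphereSupport K v ^ p ∂μ ≤ ∫ v, sphereSupport L v ^ p ∂μ) :
    ∃ c : ℝ, 0 < c ∧ ∀ f : sphere (0 : EuclideanSpace ℝ (Fin n)) 1 → ℝ, Continuous f →
      ∫ v, sphereSupport K v ^ p * f v ∂μ = c * ∫ u, radialWeight q (sphereSupport K) u *
        f (wulffNormal (sphereSupport K) (u : EuclideanSpace ℝ (Fin n)))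
          ∂(volume : Measure (EuclideanSpace ℝ (Fin n))).toSphere := by
  set h := sphereSupport K with hh
  set σ := (volume : Measure (EuclideanSpace ℝ (Fin n))).toSphere with hσ
  have hc : Continuous h := hK.isCompact.continuous_sphereSupport hK.nonempty
  have hpos : ∀ v, 0 < h v := hK.sphereSupport_pos_of_measure_ne_zero hm
  have he : ∀ v, h (-v) = h v := sphereSupport_neg hK.neg_mem
  have hWc : Continuous (radialWeight q h) := continuous_radialWeight hq hc hpos
  have hhp : Continuous fun v => h v ^ p := hc.rpow_const fun _ => Or.inr hp.le
  let N : sphere (0 : EuclideanSpace ℝ (Fin n)) 1 → sphere (0 : EuclideanSpace ℝ (Fin n)) 1 :=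
    fun u => wulffNormal h (u : EuclideanSpace ℝ (Fin n))
  have hN : AEMeasurable N σ := aemeasurable_wulffNormal_sphere hc hpos
  have hDint : ∀ f : sphere (0 : EuclideanSpace ℝ (Fin n)) 1 → ℝ, Continuous f →
      Integrable (fun u => radialWeight q h u * f (N u)) σ := by
    intro f hf
    obtain ⟨C, hC⟩ := isCompact_univ.exists_bound_of_continuousOn hf.continuousOn
    exact (integrable_of_continuous hWc).mul_bdd (c := C)
      (hf.measurable.comp_aemeasurable hN).aestronglyMeasurable
      (Eventually.of_forall fun u => hC _ (mem_univ _))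
  have hMint : ∀ f : sphere (0 : EuclideanSpace ℝ (Fin n)) 1 → ℝ, Continuous f →
      Integrable (fun v => h v ^ p * f v) μ := fun f hf =>
    integrable_of_continuous (hhp.mul hf)
  set D : (sphere (0 : EuclideanSpace ℝ (Fin n)) 1 → ℝ) → ℝ := fun f =>
    ∫ u, radialWeight q h u * f (N u) ∂σ with hD
  set M : (sphere (0 : EuclideanSpace ℝ (Fin n)) 1 → ℝ) → ℝ := fun f =>
    ∫ v, h v ^ p * f v ∂μ with hM
  have hDlin : ∀ f g, Continuous f → Continuous g → ∀ a b : ℝ,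
      D (fun v => a * f v + b * g v) = a * D f + b * D g := fun f g hf hg a b => by
    simp only [hD]
    rw [← integral_const_mul, ← integral_const_mul,
      ← integral_add ((hDint f hf).const_mul a) ((hDint g hg).const_mul b)]
    congr 1; ext u; ring
  have hMlin : ∀ f g, Continuous f → Continuous g → ∀ a b : ℝ,
      M (fun v => a * f v + b * g v) = a * M f + b * M g := fun f g hf hg a b => by
    simp only [hM]
    rw [← integral_const_mul, ← integral_const_mul,
      ← integral_add ((hMint f hf).const_mul a) ((hMint g hg).const_mul b)]
    congr 1; ext u; ring
  have hD1 : 0 < D fun _ => 1 := by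
    simp only [hD, mul_one]
    rw [integral_pos_iff_support_of_nonneg (fun u => (radialWeight_pos hc hpos u).le)
      (integrable_of_continuous hWc),
      show Function.support _ = univ from eq_univ_of_forall fun u => (radialWeight_pos hc hpos u).ne']
    exact Measure.measure_univ_pos.2 (Measure.toSphere_ne_zero _)
  have hM1 : 0 < M fun _ => 1 := by
    simp only [hM, mul_one]
    rw [integral_pos_iff_support_of_nonneg (fun u => (Real.rpow_pos_of_pos (hpos u) p).le)
      (integrable_of_continuous hhp),
      show Function.support _ = univ from
        eq_univ_of_forall fun u => (Real.rpow_pos_of_pos (hpos u) p).ne']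
    exact Measure.measure_univ_pos.2 hμ
  have key : ∀ φ : sphere (0 : EuclideanSpace ℝ (Fin n)) 1 → ℝ, Continuous φ →
      (∀ v, φ (-v) = φ v) → D φ = 0 → 0 ≤ M φ := by
    intro φ hφ hφe hφ0
    refine le_of_forall_pos_le_add fun ε hε => ?_
    -- This constant makes D positive and raises M by exactly ε.
    have h1 : 0 < D fun v => 1 * φ v + ε / M (fun _ => 1) * 1 := by
      rw [hDlin φ (fun _ => 1) hφ continuous_const, hφ0, mul_zero, zero_add]
      positivity
    have h2 := integral_nonneg_of_minimizer hp hq μ hK hm hmin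
      (φ := fun v => 1 * φ v + ε / M (fun _ => 1) * 1) (by fun_prop) (by simp [hφe]) h1
    change 0 ≤ M _ at h2
    rw [hMlin φ (fun _ => 1) hφ continuous_const, div_mul_cancel₀ _ hM1.ne', one_mul] at h2
    exact h2
  have key2 : ∀ φ : sphere (0 : EuclideanSpace ℝ (Fin n)) 1 → ℝ, Continuous φ →
      (∀ v, φ (-v) = φ v) → M φ = M (fun _ => 1) / D (fun _ => 1) * D φ := by
    intro φ hφ hφe
    -- Subtracting a constant brings s φ into the kernel of D; s = 1 and s = -1 give the two
    -- inequalities.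
    have h1 : ∀ s : ℝ, 0 ≤ s * M φ + -(s * D φ / D fun _ => 1) * M fun _ => 1 := fun s => by
      rw [← hMlin φ (fun _ => 1) hφ continuous_const]
      refine key _ (by fun_prop) (by simp [hφe]) ?_
      rw [hDlin φ (fun _ => 1) hφ continuous_const]
      field_simp
      ring
    have h2 := h1 1
    have h3 := h1 (-1)
    have h4 : M (fun _ => 1) / D (fun _ => 1) * D φ = D φ / D (fun _ => 1) * M fun _ => 1 := by
      ring
    rw [h4]
    have h5 : -(1 * D φ / D fun _ => 1) * M (fun _ => 1) =
      -(D φ / D (fun _ => 1) * M fun _ => 1) := by ring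
    have h6 : -(-1 * D φ / D fun _ => 1) * M (fun _ => 1) =
      D φ / D (fun _ => 1) * M fun _ => 1 := by ring
    rw [h5] at h2
    rw [h6] at h3
    linarith
  have hMneg : ∀ f, M (fun v => f (-v)) = M f := fun f => by
    have h1 := hμneg.integral_comp' (f := MeasurableEquiv.neg _) (fun v => h v ^ p * f v)
    simp only [hM]
    rw [← h1]
    simp [he]
  have hDneg : ∀ f, D (fun v => f (-v)) = D f := fun f => by
    have h1 := (measurePreserving_neg_toSphere (E := EuclideanSpace ℝ (Fin n))).integral_comp'
      (f := MeasurableEquiv.neg _) (fun u => radialWeight q h u * f (N u))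
    simp only [hD]
    rw [← h1]
    refine integral_congr_ae ?_
    filter_upwards [ae_toSphere_mem_regularDirs hc hpos] with u hu
    have h2 : N (-u) = -N u := wulffNormal_neg hc hpos he hu
    simp [radialWeight_neg he, h2]
  refine ⟨M (fun _ => 1) / D (fun _ => 1), div_pos hM1 hD1, fun f hf => ?_⟩
  -- Both functionals are invariant under v ↦ -v, so f may be replaced by its even part.
  have hfn : Continuous fun v => f (-v) := hf.comp continuous_neg
  have h1 := key2 (fun v => 1 / 2 * f v + 1 / 2 * f (-v)) (by fun_prop)
    (fun v => by rw [neg_neg]; ring)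
  rw [hMlin f (fun v => f (-v)) hf hfn, hDlin f (fun v => f (-v)) hf hfn, hMneg, hDneg] at h1
  have h2 : M f = M (fun _ => 1) / D (fun _ => 1) * D f := by linarith
  exact h2

/-- The Euler-Lagrange equation of the minimization problem, as an identity of measures. -/
theorem measure_eq_of_multiplier [Nontrivial (EuclideanSpace ℝ (Fin n))] {p q c : ℝ} (hq : 0 < q)
    (hc0 : 0 < c) (μ : Measure (sphere (0 : EuclideanSpace ℝ (Fin n)) 1)) [IsFiniteMeasure μ]
    {h : sphere (0 : EuclideanSpace ℝ (Fin n)) 1 → ℝ} (hc : Continuous h) (hpos : ∀ v, 0 < h v)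
    (H : ∀ f : sphere (0 : EuclideanSpace ℝ (Fin n)) 1 → ℝ, Continuous f →
      ∫ v, h v ^ p * f v ∂μ = c * ∫ u, radialWeight q h u *
        f (wulffNormal h (u : EuclideanSpace ℝ (Fin n)))
          ∂(volume : Measure (EuclideanSpace ℝ (Fin n))).toSphere)
    {η : Set (sphere (0 : EuclideanSpace ℝ (Fin n)) 1)} (hη : MeasurableSet η) :
    μ η = ENNReal.ofReal c * ∫⁻ u, η.indicator (fun v => ENNReal.ofReal (h v ^ (-p)))
      (wulffNormal h (u : EuclideanSpace ℝ (Fin n))) * ENNReal.ofReal (radialWeight q h u)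
        ∂(volume : Measure (EuclideanSpace ℝ (Fin n))).toSphere := by
  set σ := (volume : Measure (EuclideanSpace ℝ (Fin n))).toSphere with hσ
  have hWc : Continuous (radialWeight q h) := continuous_radialWeight hq hc hpos
  have hhp : Continuous fun v => h v ^ p := hc.rpow_const fun v => Or.inl (hpos v).ne'
  have hhp' : Continuous fun v => h v ^ (-p) := hc.rpow_const fun v => Or.inl (hpos v).ne'
  let N : sphere (0 : EuclideanSpace ℝ (Fin n)) 1 → sphere (0 : EuclideanSpace ℝ (Fin n)) 1 :=
    fun u => wulffNormal h (u : EuclideanSpace ℝ (Fin n))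
  have hN : AEMeasurable N σ := aemeasurable_wulffNormal_sphere hc hpos
  set A := μ.withDensity fun v => ENNReal.ofReal (h v ^ p) with hA
  set W := σ.withDensity fun u => ENNReal.ofReal (c * radialWeight q h u) with hW
  have hNW : AEMeasurable N W := hN.mono_ac (withDensity_absolutelyContinuous _ _)
  set B := W.map N with hB
  have : IsFiniteMeasure A := isFiniteMeasure_withDensity_ofReal
    (integrable_of_continuous hhp).hasFiniteIntegral
  have : IsFiniteMeasure W := isFiniteMeasure_withDensity_ofReal
    (integrable_of_continuous (hWc.const_smul c)).hasFiniteIntegral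
  -- Finite Borel measures on the sphere are determined by integrals of continuous functions. Since
  -- h > 0, integrating the indicator of η times h^(-p) then recovers μ(η).
  have hAB : A = B := by
    refine ext_of_forall_integral_eq_of_IsFiniteMeasure fun f => ?_
    rw [hB, integral_map hNW f.continuous.aestronglyMeasurable, hA, hW,
      integral_withDensity_eq_integral_toReal_smul (by fun_prop)
        (Eventually.of_forall fun _ => ENNReal.ofReal_lt_top),
      integral_withDensity_eq_integral_toReal_smul (by fun_prop)
        (Eventually.of_forall fun _ => ENNReal.ofReal_lt_top)]
    have h1 := H f f.continuous
    rw [← integral_const_mul] at h1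
    calc _ = ∫ v, h v ^ p * f v ∂μ := by
          congr 1; ext v
          rw [ENNReal.toReal_ofReal (Real.rpow_pos_of_pos (hpos v) p).le, smul_eq_mul]
      _ = _ := h1
      _ = _ := by
          congr 1; ext u
          rw [ENNReal.toReal_ofReal (mul_pos hc0 (radialWeight_pos hc hpos u)).le, smul_eq_mul,
            mul_assoc]
  have hind : Measurable (η.indicator fun v => ENNReal.ofReal (h v ^ (-p))) :=
    (Measurable.indicator (by fun_prop) hη)
  calc μ η = ∫⁻ v, η.indicator (fun v => ENNReal.ofReal (h v ^ (-p))) v ∂A := by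
        rw [hA, lintegral_withDensity_eq_lintegral_mul _ (by fun_prop) hind,
          ← lintegral_indicator_one hη]
        refine lintegral_congr fun v => ?_
        by_cases hv : v ∈ η
        · rw [Pi.mul_apply, indicator_of_mem hv, indicator_of_mem hv,
            ← ENNReal.ofReal_mul (Real.rpow_pos_of_pos (hpos v) p).le, ← Real.rpow_add (hpos v)]
          simp
        · simp [hv]
    _ = ∫⁻ u, η.indicator (fun v => ENNReal.ofReal (h v ^ (-p))) (N u) ∂W := by
        rw [hAB, hB, lintegral_map' hind.aemeasurable hNW]
    _ = ∫⁻ u, ENNReal.ofReal c * (η.indicator (fun v => ENNReal.ofReal (h v ^ (-p))) (N u) *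
          ENNReal.ofReal (radialWeight q h u)) ∂σ := by
        rw [hW, lintegral_withDensity_eq_lintegral_mul₀ (by fun_prop)
          (by exact hind.comp_aemeasurable hN)]
        refine lintegral_congr fun u => ?_
        rw [Pi.mul_apply, ENNReal.ofReal_mul hc0.le]
        ring
    _ = _ := lintegral_const_mul' _ _ ENNReal.ofReal_ne_top

end EulerLagrange

/-! ### The curvature measure in polar coordinates -/

section Curvature

variable {n : ℕ} {K : Set (EuclideanSpace ℝ (Fin n))}

/-- A point of gauge 1 is not interior, since multiplying it by any t > 1 leaves the shape. -/
theorem frontier_wulffShape [Nontrivial (EuclideanSpace ℝ (Fin n))]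
    {H : sphere (0 : EuclideanSpace ℝ (Fin n)) 1 → ℝ} (hc : Continuous H) (hp : ∀ v, 0 < H v) :
    frontier (wulffShape H) = {x | wulffGauge H x = 1} := by
  have hg := continuous_wulffGauge hc hp
  rw [wulffShape_isClosed.frontier_eq]
  ext x
  simp only [Set.mem_sdiff, mem_wulffShape_iff hc hp, mem_ofPred_eq]
  constructor
  · rintro ⟨h1, h2⟩
    refine le_antisymm h1 (not_lt.1 fun h3 => h2 ?_)
    refine mem_interior.2 ⟨{y | wulffGauge H y < 1}, fun y hy => ?_,
      isOpen_lt hg continuous_const, h3⟩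
    exact (mem_wulffShape_iff hc hp).2 (le_of_lt hy)
  · intro h1
    refine ⟨h1.le, fun h2 => ?_⟩
    have h3 : ∀ᶠ t : ℝ in 𝓝[>] 1, t • x ∈ wulffShape H := by
      have h4 : Tendsto (fun t : ℝ => t • x) (𝓝[>] 1) (𝓝 x) := by
        have : Continuous fun t : ℝ => t • x := by fun_prop
        simpa using (this.tendsto 1).mono_left nhdsWithin_le_nhds
      exact h4.eventually (mem_interior_iff_mem_nhds.1 h2)
    obtain ⟨t, ht, ht1⟩ := (h3.and self_mem_nhdsWithin).exists
    have ht1' : (1 : ℝ) < t := ht1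
    rw [mem_wulffShape_iff hc hp, wulffGauge_smul (by linarith), h1] at ht
    linarith

theorem mem_sphericalImage_iff {x : EuclideanSpace ℝ (Fin n)}
    (hx : wulffGauge (sphereSupport K) x = 1) (v : sphere (0 : EuclideanSpace ℝ (Fin n)) 1) :
    (v : EuclideanSpace ℝ (Fin n)) ∈ sphericalImage K x ↔ IsNormalDir (sphereSupport K) x v := by
  rw [IsNormalDir, hx, one_mul]
  exact ⟨fun h => h.2, fun h => ⟨v.2, h⟩⟩

theorem regularBoundary_eq [Nontrivial (EuclideanSpace ℝ (Fin n))] (hK : IsSymmConvexCompact K)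
    (hpos : ∀ v, 0 < sphereSupport K v) :
    regularBoundary K = wulffRegularBoundary (sphereSupport K) := by
  have hc := hK.isCompact.continuous_sphereSupport hK.nonempty
  have hfr : frontier K = {x | wulffGauge (sphereSupport K) x = 1} := by
    conv_lhs => rw [eq_wulffShape_sphereSupport hK.isCompact hK.convex hK.nonempty]
    exact frontier_wulffShape hc hpos
  ext x
  rw [regularBoundary, wulffRegularBoundary, mem_ofPred_eq, mem_ofPred_eq, hfr]
  refine and_congr_right fun hx => ?_
  have hx1 : wulffGauge (sphereSupport K) x = 1 := hx
  have hx0 : x ≠ 0 := by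
    rintro rfl
    rw [wulffGauge_zero] at hx1
    exact zero_ne_one hx1
  constructor
  · rintro ⟨v, hv, hu⟩
    refine ⟨hx0, ⟨v, hv.1⟩, (mem_sphericalImage_iff hx1 ⟨v, hv.1⟩).1 hv, fun w hw => ?_⟩
    exact Subtype.ext (hu w ((mem_sphericalImage_iff hx1 w).2 hw))
  · rintro ⟨-, v, hv, hu⟩
    refine ⟨v, (mem_sphericalImage_iff hx1 v).2 hv, fun w hw => ?_⟩
    exact congrArg Subtype.val (hu ⟨w, hw.1⟩ ((mem_sphericalImage_iff hx1 ⟨w, hw.1⟩).1 hw))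

theorem gaussMap_eq [Nontrivial (EuclideanSpace ℝ (Fin n))] (hK : IsSymmConvexCompact K)
    (hpos : ∀ v, 0 < sphereSupport K v) {x : EuclideanSpace ℝ (Fin n)}
    (hx : x ∈ wulffRegularBoundary (sphereSupport K)) :
    gaussMap K x = wulffNormal (sphereSupport K) x := by
  have hc := hK.isCompact.continuous_sphereSupport hK.nonempty
  have hx' : x ∈ regularBoundary K := by rwa [regularBoundary_eq hK hpos]
  rw [gaussMap, dif_pos hx']
  refine hx'.2.unique hx'.2.choose_spec.1 ?_
  exact (mem_sphericalImage_iff hx.1 _).2 (isNormalDir_wulffNormal hc hpos x)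

theorem inverseGaussImage_eq [Nontrivial (EuclideanSpace ℝ (Fin n))] (hK : IsSymmConvexCompact K)
    (hpos : ∀ v, 0 < sphereSupport K v) (η : Set (sphere (0 : EuclideanSpace ℝ (Fin n)) 1)) :
    inverseGaussImage K η =
      wulffRegularBoundary (sphereSupport K) ∩ wulffNormal (sphereSupport K) ⁻¹' η := by
  ext x
  rw [inverseGaussImage, mem_ofPred_eq, regularBoundary_eq hK hpos]
  refine and_congr_right fun hx => ?_
  rw [gaussMap_eq hK hpos hx, Subtype.val_injective.mem_set_image]
  rfl

theorem continuousOn_wulffNormal_regularBoundary [Nontrivial (EuclideanSpace ℝ (Fin n))]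
    {H : sphere (0 : EuclideanSpace ℝ (Fin n)) 1 → ℝ} (hc : Continuous H) (hp : ∀ v, 0 < H v) :
    ContinuousOn (wulffNormal H) (wulffRegularBoundary H) :=
  (continuousOn_wulffNormal hc hp).mono fun _ hx => hx.2

/-- Polar coordinate formula for the `L_p` Gaussian dual curvature measure. -/
theorem exists_lpGaussianDualCurvature_eq (k : ℕ) :
    ∃ C : ℝ≥0∞, C ≠ 0 ∧ C ≠ ∞ ∧ ∀ (p q : ℝ) (K : Set (EuclideanSpace ℝ (Fin (k + 1)))),
      IsSymmConvexCompact K → (∀ v, 0 < sphereSupport K v) →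
      ∀ η : Set (sphere (0 : EuclideanSpace ℝ (Fin (k + 1))) 1), MeasurableSet η →
        lpGaussianDualCurvature p q K η =
          C * ∫⁻ u, η.indicator (fun v => ENNReal.ofReal (sphereSupport K v ^ (-p)))
            (wulffNormal (sphereSupport K) (u : EuclideanSpace ℝ (Fin (k + 1)))) *
              ENNReal.ofReal (radialWeight q (sphereSupport K) u)
                ∂(volume : Measure (EuclideanSpace ℝ (Fin (k + 1)))).toSphere := by
  have hE : Module.finrank ℝ (EuclideanSpace ℝ (Fin (k + 1))) = k + 1 := finrank_euclideanSpace_fin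
  obtain ⟨κ, hκ0, hκt, hκ⟩ := exists_coneMeasure_eq hE
  set b := volume (ball (0 : EuclideanSpace ℝ (Fin (k + 1 - 1))) (1 / 2)) with hb
  have hb0 : b ≠ 0 := (measure_ball_pos _ _ (by norm_num)).ne'
  have hbt : b ≠ ∞ := measure_ball_lt_top.ne
  have hk0 : ENNReal.ofReal (1 / ((k : ℝ) + 1)) ≠ 0 := (ENNReal.ofReal_pos.2 (by positivity)).ne'
  refine ⟨b * (κ⁻¹ * ENNReal.ofReal (1 / ((k : ℝ) + 1))),
    mul_ne_zero hb0 (mul_ne_zero (ENNReal.inv_ne_zero.2 hκt) hk0),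
    ENNReal.mul_ne_top hbt (ENNReal.mul_ne_top (ENNReal.inv_ne_top.2 hκ0) ENNReal.ofReal_ne_top),
    fun p q K hK hpos η hη => ?_⟩
  set h := sphereSupport K with hh
  have hc : Continuous h := hK.isCompact.continuous_sphereSupport hK.nonempty
  set R := wulffRegularBoundary h with hR
  have hRm : MeasurableSet R := measurableSet_wulffRegularBoundary hc hpos
  have hNc : ContinuousOn (wulffNormal h) R := continuousOn_wulffNormal_regularBoundary hc hpos
  have hx0 : ∀ x ∈ R, x ≠ 0 := fun x hx => hx.2.1
  set ν : Measure (EuclideanSpace ℝ (Fin (k + 1))) := Measure.hausdorffMeasure (k : ℝ) with hν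
  set I := R ∩ wulffNormal h ⁻¹' η with hI
  have hNae : ∀ m : Measure (EuclideanSpace ℝ (Fin (k + 1))),
      AEMeasurable (wulffNormal h) (m.restrict R) := fun m => hNc.aemeasurable hRm
  have hIm : MeasurableSet I := by
    have h1 := (continuousOn_iff_continuous_domRestrict.1 hNc).measurable hη
    have h2 := (MeasurableEmbedding.subtype_coe hRm).measurableSet_image.2 h1
    convert h2 using 1
    ext x
    simp [hI, and_comm]
  set G : EuclideanSpace ℝ (Fin (k + 1)) → ℝ≥0∞ := fun x =>
    ENNReal.ofReal (h (wulffNormal h x) ^ (-p) * ‖x‖ ^ (q - ((k + 1 : ℕ) : ℝ)) *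
      Real.exp (-(‖x‖ ^ 2) / 2)) with hG
  have hGc : ContinuousOn G R := by
    refine ENNReal.continuous_ofReal.comp_continuousOn ((ContinuousOn.mul ?_ ?_).mul ?_)
    · exact (hc.comp_continuousOn hNc).rpow_const fun x _ => Or.inl (hpos _).ne'
    · exact continuous_norm.continuousOn.rpow_const fun x hx => Or.inl (norm_ne_zero_iff.2 (hx0 x hx))
    · exact Continuous.continuousOn (by fun_prop)
  -- G is continuous only on R; cutting it off outside I makes it Borel on the whole space, as
  -- integration against the cone measure needs.
  have hGm : Measurable (I.indicator G) := by
    have h1 : Measurable (R.indicator G) := by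
      classical
      have := hGc.measurable_piecewise (g := fun _ => 0) continuousOn_const hRm
      rwa [show R.piecewise G (fun _ => 0) = R.indicator G from piecewise_eq_indicator] at this
    have h2 : I.indicator G = I.indicator (R.indicator G) := by
      rw [indicator_indicator, inter_eq_left.2 inter_subset_left]
    rw [h2]
    exact h1.indicator hIm
  have hhN : AEMeasurable (fun x => κ * ENNReal.ofReal (h (wulffNormal h x))) (ν.restrict R) :=
    (ENNReal.measurable_ofReal.comp_aemeasurable
      (hc.measurable.comp_aemeasurable (hNae ν))).const_mul κ
  have hdim : (((k + 1 : ℕ) : ℝ) - 1) = (k : ℝ) := by push_cast; ring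
  calc lpGaussianDualCurvature p q K η
      = b * ∫⁻ x in I, ENNReal.ofReal ((inner ℝ x (gaussMap K x)) ^ (1 - p) *
          ‖x‖ ^ (q - ((k + 1 : ℕ) : ℝ)) * Real.exp (-(‖x‖ ^ 2) / 2)) ∂ν := by
        rw [lpGaussianDualCurvature, inverseGaussImage_eq hK hpos, surfaceHausdorff, hdim,
          Measure.restrict_smul, lintegral_smul_measure, smul_eq_mul]
    -- At a regular boundary point ⟨x,ν⟩ = h(ν). One factor of h^(1-p) is split off to form the
    -- density of the cone measure.
    _ = b * ∫⁻ x in I, κ⁻¹ * (κ * ENNReal.ofReal (h (wulffNormal h x)) * G x) ∂ν := by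
        congr 1
        refine setLIntegral_congr_fun hIm fun x hx => ?_
        have hxp := hpos (wulffNormal h x)
        rw [gaussMap_eq hK hpos hx.1, wulffRegularBoundary_apply_eq hc hpos hx.1, mul_assoc κ,
          ENNReal.inv_mul_cancel_left hκ0 hκt, hG, ← ENNReal.ofReal_mul hxp.le,
          ← mul_assoc, ← mul_assoc, sub_eq_add_neg, Real.rpow_add hxp, Real.rpow_one]
    _ = b * (κ⁻¹ * ∫⁻ x in I, κ * ENNReal.ofReal (h (wulffNormal h x)) * G x ∂ν) := by
        rw [lintegral_const_mul' _ _ (ENNReal.inv_ne_top.2 hκ0)]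
    _ = b * (κ⁻¹ * ∫⁻ x in R, κ * ENNReal.ofReal (h (wulffNormal h x)) * I.indicator G x ∂ν) := by
        congr 2
        rw [← lintegral_indicator hIm, ← lintegral_indicator hRm]
        refine lintegral_congr fun x => ?_
        by_cases hx : x ∈ I
        · rw [indicator_of_mem hx, indicator_of_mem hx.1, indicator_of_mem hx]
        · rw [indicator_of_notMem hx]
          by_cases hxR : x ∈ R
          · rw [indicator_of_mem hxR, indicator_of_notMem hx, mul_zero]
          · rw [indicator_of_notMem hxR]
    _ = b * (κ⁻¹ * ∫⁻ x, I.indicator G x ∂(coneMeasure h).restrict R) := by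
        rw [← hκ h hc hpos, lintegral_withDensity_eq_lintegral_mul₀ hhN hGm.aemeasurable]
        rfl
    _ = b * (κ⁻¹ * ∫⁻ x, I.indicator G x ∂(coneMeasure h)) := by
        congr 2
        rw [← lintegral_indicator hRm, indicator_indicator, inter_eq_right.2 inter_subset_left]
    _ = b * (κ⁻¹ * ∫⁻ u, ENNReal.ofReal (1 / ((k : ℝ) + 1)) *
          (η.indicator (fun v => ENNReal.ofReal (h v ^ (-p)))
            (wulffNormal h (u : EuclideanSpace ℝ (Fin (k + 1)))) *
              ENNReal.ofReal (radialWeight q h u))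
                ∂(volume : Measure (EuclideanSpace ℝ (Fin (k + 1)))).toSphere) := by
        rw [lintegral_coneMeasure hE hc hpos hGm]
        congr 2
        refine lintegral_congr_ae ?_
        filter_upwards [ae_toSphere_mem_regularDirs hc hpos] with u hu
        set ρ := (wulffGauge h (u : EuclideanSpace ℝ (Fin (k + 1))))⁻¹ with hρ
        have hg := wulffGauge_sphere_pos hc hpos u
        have hρp : 0 < ρ := inv_pos.2 hg
        have hmem : ρ • (u : EuclideanSpace ℝ (Fin (k + 1))) ∈ R := by
          refine ⟨?_, (smul_mem_regularDirs_iff hρp).2 hu⟩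
          rw [wulffGauge_smul hρp.le, hρ, inv_mul_cancel₀ hg.ne']
        have hNu := wulffNormal_smul hc hpos hu hρp
        by_cases huη : wulffNormal h (u : EuclideanSpace ℝ (Fin (k + 1))) ∈ η
        · have hmemI : ρ • (u : EuclideanSpace ℝ (Fin (k + 1))) ∈ I :=
            ⟨hmem, by rw [mem_preimage, hNu]; exact huη⟩
          have hxp := Real.rpow_pos_of_pos (hpos (wulffNormal h
            (u : EuclideanSpace ℝ (Fin (k + 1))))) (-p)
          rw [indicator_of_mem hmemI, indicator_of_mem huη, hG]
          simp only
          rw [hNu, norm_smul, norm_sphere_coe, mul_one,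
            Real.norm_of_nonneg hρp.le, ← ENNReal.ofReal_mul hxp.le,
            ← ENNReal.ofReal_mul (by positivity), ← ENNReal.ofReal_mul (by positivity),
            radialWeight, ← hρ]
          congr 1
          -- The ρ^n of the cone measure cancels the -n in the exponent q-n of |x|.
          have h1 : ρ ^ (k + 1) * ρ ^ (q - ((k + 1 : ℕ) : ℝ)) = ρ ^ q := by
            rw [← Real.rpow_natCast, ← Real.rpow_add hρp]
            congr 1
            ring
          rw [← h1]
          ring
        · have hmemI : ρ • (u : EuclideanSpace ℝ (Fin (k + 1))) ∉ I := fun hI' => by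
            have := hI'.2
            rw [mem_preimage, hNu] at this
            exact huη this
          rw [indicator_of_notMem hmemI, indicator_of_notMem huη, mul_zero, zero_mul, mul_zero]
    _ = _ := by
        rw [lintegral_const_mul' _ _ ENNReal.ofReal_ne_top]
        ring

/-- The cone over a great subsphere lies in a hyperplane. -/
theorem toSphere_inner_eq_zero {e : EuclideanSpace ℝ (Fin n)} (he : e ≠ 0) :
    (volume : Measure (EuclideanSpace ℝ (Fin n))).toSphere
      {v : sphere (0 : EuclideanSpace ℝ (Fin n)) 1 |
        inner ℝ e (v : EuclideanSpace ℝ (Fin n)) = 0} = 0 := by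
  have hm : MeasurableSet {v : sphere (0 : EuclideanSpace ℝ (Fin n)) 1 |
      inner ℝ e (v : EuclideanSpace ℝ (Fin n)) = 0} :=
    (isClosed_eq (by fun_prop) continuous_const).measurableSet
  have h0 : volume (((ℝ ∙ e)ᗮ : Submodule ℝ (EuclideanSpace ℝ (Fin n))) :
      Set (EuclideanSpace ℝ (Fin n))) = 0 := by
    refine Measure.addHaar_submodule volume _ fun htop => ?_
    have : e ∈ (ℝ ∙ e)ᗮ := by rw [htop]; trivial
    rw [Submodule.mem_orthogonal_singleton_iff_inner_left, inner_self_eq_zero] at this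
    exact he this
  rw [Measure.toSphere_apply' _ hm, measure_mono_null ?_ h0, mul_zero]
  rintro _ ⟨r, hr, _, ⟨v, hv, rfl⟩, rfl⟩
  have hv' : inner ℝ e (v : EuclideanSpace ℝ (Fin n)) = 0 := hv
  rw [SetLike.mem_coe, Submodule.mem_orthogonal_singleton_iff_inner_right]
  simp only [real_inner_smul_right, hv', mul_zero]

theorem MeasurePreserving.withDensity_of_comp_eq {X : Type*} [MeasurableSpace X] {σ : Measure X}
    {T : X → X} (hT : MeasurePreserving T σ σ) {g : X → ℝ≥0∞} (hg : Measurable g)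
    (hgT : ∀ x, g (T x) = g x) : MeasurePreserving T (σ.withDensity g) (σ.withDensity g) := by
  refine ⟨hT.measurable, Measure.ext fun s hs => ?_⟩
  rw [Measure.map_apply hT.measurable hs, withDensity_apply _ (hT.measurable hs),
    withDensity_apply _ hs, ← hT.setLIntegral_comp_preimage hs hg]
  simp only [hgT]

end Curvature

/-! ### The normalised Minkowski problem -/

theorem theorem1p1 (n : ℕ) (p q : ℝ) (hp : 0 < p) (hq : 0 < q)
    (μ : Measure (sphere (0 : EuclideanSpace ℝ (Fin n)) 1)) [IsFiniteMeasure μ] (hμ : μ ≠ 0)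
    (f : sphere (0 : EuclideanSpace ℝ (Fin n)) 1 → ℝ) (hf_meas : Measurable f)
    (hf_nonneg : ∀ v, 0 ≤ f v) (hf_even : ∀ v, f (-v) = f v)
    (hμf : μ = ((volume : Measure (EuclideanSpace ℝ (Fin n))).toSphere).withDensity
      (fun v => ENNReal.ofReal (f v))) :
    ∃ K : ConvexBody (EuclideanSpace ℝ (Fin n)),
      (interior (K : Set (EuclideanSpace ℝ (Fin n)))).Nonempty ∧
      (∀ x ∈ K, -x ∈ K) ∧
      lpGaussianDualCurvature p q (K : Set (EuclideanSpace ℝ (Fin n))) Set.univ ≠ 0 ∧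
      lpGaussianDualCurvature p q (K : Set (EuclideanSpace ℝ (Fin n))) Set.univ ≠ ∞ ∧
      ∀ η : Set (sphere (0 : EuclideanSpace ℝ (Fin n)) 1), MeasurableSet η →
        μ η / μ Set.univ =
          lpGaussianDualCurvature p q (K : Set (EuclideanSpace ℝ (Fin n))) η /
            lpGaussianDualCurvature p q (K : Set (EuclideanSpace ℝ (Fin n))) Set.univ := by
  obtain _ | k := n
  -- In dimension 0 the sphere is empty, which contradicts μ ≠ 0.
  · have : IsEmpty (sphere (0 : EuclideanSpace ℝ (Fin 0)) 1) :=
      ⟨fun v => sphere_coe_ne_zero v (Subsingleton.elim _ _)⟩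
    exact absurd (Measure.eq_zero_of_isEmpty μ) hμ
  have hnull : ∀ e : EuclideanSpace ℝ (Fin (k + 1)), e ≠ 0 →
      μ {v : sphere (0 : EuclideanSpace ℝ (Fin (k + 1))) 1 |
        inner ℝ e (v : EuclideanSpace ℝ (Fin (k + 1))) = 0} = 0 := fun e he => by
    rw [hμf]
    exact withDensity_absolutelyContinuous _ _ (toSphere_inner_eq_zero he)
  have hneg : MeasurePreserving (fun v : sphere (0 : EuclideanSpace ℝ (Fin (k + 1))) 1 => -v) μ μ := by
    rw [hμf]
    exact MeasurePreserving.withDensity_of_comp_eq measurePreserving_neg_toSphere (by fun_prop)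
      fun v => by rw [hf_even]
  obtain ⟨K, hK, hm, hmin⟩ := exists_minimizer hp hq μ hμ hnull
  have hpos := hK.sphereSupport_pos_of_measure_ne_zero hm
  have hc := hK.isCompact.continuous_sphereSupport hK.nonempty
  obtain ⟨c, hc0, hEL⟩ := exists_multiplier_of_minimizer hp hq μ hμ hneg hK hm hmin
  obtain ⟨C, hC0, hCt, hC⟩ := exists_lpGaussianDualCurvature_eq k
  -- The Euler-Lagrange equation and the polar formula involve the same integral, so the two
  -- measures are proportional and the factor cancels in the quotient.
  have key : ∀ η : Set (sphere (0 : EuclideanSpace ℝ (Fin (k + 1))) 1), MeasurableSet η →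
      lpGaussianDualCurvature p q K η = C * (ENNReal.ofReal c)⁻¹ * μ η := fun η hη => by
    rw [measure_eq_of_multiplier hq hc0 μ hc hpos hEL hη, hC p q K hK hpos η hη, mul_assoc,
      ENNReal.inv_mul_cancel_left (ENNReal.ofReal_pos.2 hc0).ne' ENNReal.ofReal_ne_top]
  have hD0 : C * (ENNReal.ofReal c)⁻¹ ≠ 0 :=
    mul_ne_zero hC0 (ENNReal.inv_ne_zero.2 ENNReal.ofReal_ne_top)
  have hDt : C * (ENNReal.ofReal c)⁻¹ ≠ ∞ :=
    ENNReal.mul_ne_top hCt (ENNReal.inv_ne_top.2 (ENNReal.ofReal_pos.2 hc0).ne')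
  refine ⟨⟨K, hK.convex, hK.isCompact, hK.nonempty⟩, ⟨0, ?_⟩, hK.neg_mem, ?_, ?_, fun η hη => ?_⟩
  · have := zero_mem_interior_wulffShape hc hpos
    rwa [← eq_wulffShape_sphereSupport hK.isCompact hK.convex hK.nonempty] at this
  · rw [ConvexBody.coe_mk, key _ MeasurableSet.univ]
    exact mul_ne_zero hD0 (Measure.measure_univ_ne_zero.2 hμ)
  · rw [ConvexBody.coe_mk, key _ MeasurableSet.univ]
    exact ENNReal.mul_ne_top hDt (measure_ne_top μ _)
  · rw [ConvexBody.coe_mk, key _ hη, key _ MeasurableSet.univ,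
      ENNReal.mul_div_mul_left _ _ hD0 hDt]

end
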